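/- Notation. For each sample size $n$ let $p=p_n\ge 2$ features be partitioned into $D=D_n$ blocks, and let $X_1,\dots,X_n$ be i.i.d. $\mathcal N(0,\Sigma)$ in $\mathbb R^p$, with $\Sigma=\Sigma_n$, $\Sigma_{jj}=1$ for all $j$. Let $\Lambda$ be the block-diagonal part of $\Sigma$ (entries within blocks are kept, all others are set to $0$), let $\hat\Sigma=\frac1n\sum_{k}X_kX_k^\top$, let $\hat\Lambda$ be the block-diagonal part of $\hat\Sigma$, and let $f(\beta)=\beta^\top\hat\Sigma\beta/\beta^\top\hat\Lambda\beta$. For $j=1,\dots,p$ let $\xi_j$ be a maximizer of $\beta^\top\Sigma\beta/\beta^\top\Lambda\beta$ over all $\beta$ with $\|\beta\|_2=1$ and $\beta^\top\Lambda\xi_{j'}=0$ for all $j'<j$, and let $\rho_j=\xi_j^\top\Sigma\xi_j/\xi_j^\top\Lambda\xi_j$. Let $s=\|\xi_1\|_0$ be the number of non-zero entries of $\xi_1$. Assumptions. There are constants $M,\gamma,C>0$ such that for all $n$: every diagonal block $\Sigma_{[d][d]}$ has all eigenvalues in $[1/M,M]$; $\rho_1\ge 1+C$; $\rho_1-\rho_2\ge\gamma\rho_1$.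 Moreover, as $n\to\infty$, $p\to\infty$ and $\frac{s\ln p}{n}\to 0$. Algorithm. Let $0<c_0<1$, let $0<\eta\le\frac{1-c_0}{2M(M+3)}$ be a constant step size, let $c_{B_1},c_{B_2}>0$ be constants, let $L_0=(1+c_{B_1})\sqrt s$, let $1\le L_\infty\le L_0$ ($L_\infty$ may depend on $n$), and let $L_t=L_\infty+\bigl(1-c_{B_2}\eta\sqrt{\tfrac{s\ln p}{n}}\bigr)^t(L_0-L_\infty)$. Given a unit vector $\beta_0$, the iterates are $$\beta_{t+1}\in\arg\min_{\|\beta\|_2=1,\ \|\beta\|_1\le L_{t+1}}\|\beta-\theta_t\|_2^2,\qquad \theta_t=\beta_t+\frac{\eta}{f(\beta_t)}\bigl(\hat\Sigma-f(\beta_t)\hat\Lambda\bigr)\beta_t ,$$ any minimizer being allowed. Set $\delta_t=1-|\beta_t^\top\xi_1|$, $\nu=\frac{(1-c_0)\gamma^2}{M}$, $B_t=L_t-\|\xi_1\|_1$ and $$T^*=\sup\Bigl\{t:\ B_t\ge\frac{4c_{B_2}(1+c_{B_1})}{\nu}\sqrt{\frac{s^2\ln p}{n}}\Bigr\}\in\mathbb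 N\cup\{\infty\}$$ (which is a maximum for all large $n$ if $L_\infty\le\|\xi_1\|_1$). Theorem. There are constants $\psi_1,\psi_2>0$, depending only on $(M,\gamma,\eta,c_0,c_{B_1},c_{B_2})$, such that, with probability tending to $1$ as $n\to\infty$, for every (possibly data-dependent) unit vector $\beta_0$ with $\|\beta_0\|_1\le L_0$ and $\delta_0\le\psi_1$ and all iterates started from it, $$\delta_t\le\psi_2\left(\delta_0(1-\eta\nu)^t+\frac{s\ln p}{n}+\sqrt{\frac{s\ln p}{n}}\left(\frac{B_t}{\sqrt s}+\frac{B_t^2}{s}\right)\right)\qquad\text{for all } t\le T^*.$$ -/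

import Mathlib

namespace MsCCA

open MeasureTheory ProbabilityTheory

/-- The `ℓ₁` norm of a coordinate vector. -/
def l1norm {p : ℕ} (v : Fin p → ℝ) : ℝ := ∑ i, |v i|

/-- The number of non-zero coordinates of a vector. -/
noncomputable def l0norm {p : ℕ} (v : Fin p → ℝ) : ℕ := {i | v i ≠ 0}.ncard

/-- The vector has Euclidean norm one. -/
def IsUnitVec {p : ℕ} (v : Fin p → ℝ) : Prop := v ⬝ᵥ v = 1

/-- The `p` features are split into `D` blocks; `blk i` is the block of feature `i`.
`blockDiag blk H` keeps the within-block entries of `H` and sets the others to zero. -/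
def blockDiag {p D : ℕ} (blk : Fin p → Fin D) (H : Matrix (Fin p) (Fin p) ℝ) :
    Matrix (Fin p) (Fin p) ℝ :=
  Matrix.of fun i j => if blk i = blk j then H i j else 0

/-- The principal submatrix of `H` on the features of block `d`. -/
def block {p D : ℕ} (blk : Fin p → Fin D) (H : Matrix (Fin p) (Fin p) ℝ) (d : Fin D) :
    Matrix {i // blk i = d} {i // blk i = d} ℝ :=
  H.submatrix Subtype.val Subtype.val

/-- The generalized Rayleigh quotient `βᵀ S β / βᵀ Λ β`. -/
noncomputable def rayleigh {p : ℕ} (S Lam : Matrix (Fin p) (Fin p) ℝ) (β : Fin p → ℝ) : ℝ :=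
  (β ⬝ᵥ (S.mulVec β)) / (β ⬝ᵥ (Lam.mulVec β))

/-- `ξ 1, …, ξ p` are successive mCCA directions of the pair `(S, Lam)`: `ξ j` maximizes the
Rayleigh quotient among the unit vectors that are `Lam`-orthogonal to all `ξ j'` with `j' < j`.
The values of `ξ` outside `1, …, p` play no role. -/
def IsMCCADirections {p : ℕ} (S Lam : Matrix (Fin p) (Fin p) ℝ) (ξ : ℕ → Fin p → ℝ) : Prop :=
  ∀ j ∈ Finset.Icc 1 p,
    ξ j ∈ {β | IsUnitVec β ∧ ∀ j' ∈ Finset.Ico 1 j, β ⬝ᵥ (Lam.mulVec (ξ j')) = 0} ∧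
    IsMaxOn (rayleigh S Lam)
      {β | IsUnitVec β ∧ ∀ j' ∈ Finset.Ico 1 j, β ⬝ᵥ (Lam.mulVec (ξ j')) = 0} (ξ j)

/-- The rows of the `n × p` random matrix `X` are independent with law `N(0, S)`. -/
structure IsGaussianSample {Ω : Type*} [MeasurableSpace Ω] (P : Measure Ω) {n p : ℕ}
    (S : Matrix (Fin p) (Fin p) ℝ) (X : Ω → Matrix (Fin n) (Fin p) ℝ) : Prop where
  law : ∀ k, HasLaw (fun ω => WithLp.toLp 2 (X ω k)) (multivariateGaussian 0 S) P
  indep : iIndepFun (fun k ω => X ω k) P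

/-- The empirical covariance `Xᵀ X / n`. -/
noncomputable def empCov {n p : ℕ} (X : Matrix (Fin n) (Fin p) ℝ) : Matrix (Fin p) (Fin p) ℝ :=
  (n : ℝ)⁻¹ • (X.transpose * X)

/-- The proximal target `β + (η / f(β)) (S - f(β) Lam) β`, where `f` is the Rayleigh quotient. -/
noncomputable def proxTarget {p : ℕ} (S Lam : Matrix (Fin p) (Fin p) ℝ) (η : ℝ)
    (β : Fin p → ℝ) : Fin p → ℝ :=
  β + (η / rayleigh S Lam β) • ((S - rayleigh S Lam β • Lam).mulVec β)

/-- The unit vectors with `ℓ₁` norm at most `L`. -/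
def feasible (p : ℕ) (L : ℝ) : Set (Fin p → ℝ) := {β | IsUnitVec β ∧ l1norm β ≤ L}

/-- `β 0, β 1, …` is a run of the proximal gradient algorithm with bounds `L 1, L 2, …`:
`β (t+1)` is a feasible vector (any of them, if there are several) that is closest to the
proximal target of `β t` in Euclidean distance. -/
def IsProximalRun {p : ℕ} (S Lam : Matrix (Fin p) (Fin p) ℝ) (η : ℝ) (L : ℕ → ℝ)
    (β : ℕ → Fin p → ℝ) : Prop :=
  ∀ t, β (t + 1) ∈ feasible p (L (t + 1)) ∧
    IsMinOn (fun b => (b - proxTarget S Lam η (β t)) ⬝ᵥ (b - proxTarget S Lam η (β t)))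
      (feasible p (L (t + 1))) (β (t + 1))

/-- The discrepancy `1 - |βᵀ ξ|`. -/
def disc {p : ℕ} (ξ β : Fin p → ℝ) : ℝ := 1 - |β ⬝ᵥ ξ|

/-- `s ln p / n`. -/
noncomputable def rate (s p n : ℕ) : ℝ := (s : ℝ) * Real.log p / n

/-- The decaying bounds `L_t = L_∞ + (1 - c₂ η √(s ln p / n))^t (L₀ - L_∞)` with
`L₀ = (1 + c₁) √s`. -/
noncomputable def bound (c₁ c₂ η Linf : ℝ) (s p n t : ℕ) : ℝ :=
  Linf + (1 - c₂ * η * √(rate s p n)) ^ t * ((1 + c₁) * √(s : ℝ) - Linf)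

/-- `T* = max {t : B_t ≥ (4 c₂ (1 + c₁) / ν) √(s² ln p / n)}`, as a supremum in `ℕ ∪ {∞}`. -/
noncomputable def stopTime (c₁ c₂ ν : ℝ) (s p n : ℕ) (B : ℕ → ℝ) : ℕ∞ :=
  ⨆ t ∈ {t : ℕ | 4 * c₂ * (1 + c₁) / ν * √((s : ℝ) ^ 2 * Real.log p / n) ≤ B t}, (t : ℕ∞)

end MsCCA

namespace MsCCA
open Matrix

/-! The Lyapunov function is Q(β) = βᵀ(Λ − Σ/ρ₁)β (`excess`). This form is positive semidefinite,
has ξ₁ in its kernel, is at most M on unit vectors, and by the relative eigengap is at least (γ/M)(1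
− (βᵀξ₁)²) there; hence Q and δ agree up to constants. Dividing by ρ₁ keeps every constant
independent of ρ₁, which may grow with n.

A closest feasible unit vector maximizes the inner product with θ_t, so β_{t+1} does at least as
well as any feasible competitor. The competitor is the normalization of (1 − κ)β_t + κξ₁ with κ =
ηγ/M and the sign of ξ₁ adapted to β_t. It is feasible because mixing in ξ₁ shrinks the ℓ₁ slack B_t
by the factor 1 − κ, whereas up to T* the bounds L_t decrease more slowly than that. With population
matrices the comparison contracts Q by 1 − κ up to higher-order terms, and a multiple of ‖β_{t+1} −
β_t‖² is left over to absorb errors.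

The bilinear forms of the empirical matrices err by O(r), r = √(s ln p / n), in the norm ‖·‖₂ +
‖·‖₁/√s. Feasible vectors lie in a cone around ξ₁ on which this norm is O(‖β − ξ₁‖₂ + b_t), b_t =
B_t/√s. Thus Q_{t+1} ≤ (1 − ην)Q_t + A r b_t (`exists_excess_step`). As b_t decays more slowly than
the contraction, the accumulated noise is O(r b_t) (`recursion_bound`, `exists_disc_bound`).

The uniform error bound (`measure_not_uniform_le`) comes from rounding to integer vectors with
squared norm at most 4s, of which there are p^{O(s)}, and a Chernoff bound at each of them. Blocks
of one observation are dependent, so Jensen's inequality replaces independence across blocks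
(`integral_exp_sum_sq_le`). -/

/-- The Euclidean norm of a coordinate vector. -/
noncomputable def l2norm {p : ℕ} (v : Fin p → ℝ) : ℝ := √(v ⬝ᵥ v)

/-- The norm `‖v‖₂ + ‖v‖₁ / √s`. -/
noncomputable def mixedNorm {p : ℕ} (s : ℕ) (v : Fin p → ℝ) : ℝ := l2norm v + l1norm v / √(s : ℝ)

/-! ### ℓ₁ geometry: mixed norm and cone condition. -/

section Norms
variable {p : ℕ}

theorem dotProduct_self_nonneg' (v : Fin p → ℝ) : 0 ≤ v ⬝ᵥ v :=
  Finset.sum_nonneg fun i _ => mul_self_nonneg (v i)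

theorem l2norm_nonneg (v : Fin p → ℝ) : 0 ≤ l2norm v := Real.sqrt_nonneg _

theorem l2norm_sq (v : Fin p → ℝ) : l2norm v ^ 2 = v ⬝ᵥ v :=
  Real.sq_sqrt (dotProduct_self_nonneg' v)

theorem l2norm_ne_zero {v : Fin p → ℝ} (hv : v ≠ 0) : l2norm v ≠ 0 := fun h0 => by
  have := l2norm_sq v
  rw [h0] at this
  exact hv (dotProduct_self_eq_zero.1 (by simpa using this.symm))

theorem l2norm_eq_norm (v : Fin p → ℝ) : l2norm v = ‖WithLp.toLp 2 v‖ := by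
  simp [l2norm, EuclideanSpace.norm_eq, dotProduct, pow_two]

theorem l2norm_add_le (u v : Fin p → ℝ) : l2norm (u + v) ≤ l2norm u + l2norm v := by
  simpa [l2norm_eq_norm] using norm_add_le (WithLp.toLp 2 u) (WithLp.toLp 2 v)

theorem l2norm_sub_le (u v : Fin p → ℝ) : l2norm (u - v) ≤ l2norm u + l2norm v := by
  simpa [l2norm_eq_norm] using norm_sub_le (WithLp.toLp 2 u) (WithLp.toLp 2 v)

theorem l2norm_smul (c : ℝ) (v : Fin p → ℝ) : l2norm (c • v) = |c| * l2norm v := by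
  simp [l2norm_eq_norm, norm_smul]

theorem l1norm_nonneg (v : Fin p → ℝ) : 0 ≤ l1norm v := Finset.sum_nonneg fun _ _ => abs_nonneg _

theorem l1norm_add_le (u v : Fin p → ℝ) : l1norm (u + v) ≤ l1norm u + l1norm v := by
  unfold l1norm
  rw [← Finset.sum_add_distrib]
  exact Finset.sum_le_sum fun i _ => abs_add_le _ _

theorem l1norm_smul (c : ℝ) (v : Fin p → ℝ) : l1norm (c • v) = |c| * l1norm v := by
  simp [l1norm, abs_mul, Finset.mul_sum]

theorem l1norm_neg (v : Fin p → ℝ) : l1norm (-v) = l1norm v := by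
  simp [l1norm]

theorem mixedNorm_nonneg (s : ℕ) (v : Fin p → ℝ) : 0 ≤ mixedNorm s v :=
  add_nonneg (l2norm_nonneg v) (div_nonneg (l1norm_nonneg v) (Real.sqrt_nonneg _))

theorem mixedNorm_add_le (s : ℕ) (u v : Fin p → ℝ) :
    mixedNorm s (u + v) ≤ mixedNorm s u + mixedNorm s v := by
  have h1 := l2norm_add_le u v
  have h2 := div_le_div_of_nonneg_right (l1norm_add_le u v) (Real.sqrt_nonneg (s : ℝ))
  rw [add_div] at h2
  unfold mixedNorm
  linarith

theorem mixedNorm_smul (s : ℕ) (c : ℝ) (v : Fin p → ℝ) :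
    mixedNorm s (c • v) = |c| * mixedNorm s v := by
  rw [mixedNorm, mixedNorm, l2norm_smul, l1norm_smul]; ring

theorem mixedNorm_neg (s : ℕ) (v : Fin p → ℝ) : mixedNorm s (-v) = mixedNorm s v := by
  simpa using mixedNorm_smul s (-1) v

theorem mixedNorm_sub_le (s : ℕ) (u v : Fin p → ℝ) :
    mixedNorm s (u - v) ≤ mixedNorm s u + mixedNorm s v := by
  simpa [sub_eq_add_neg, mixedNorm_neg] using mixedNorm_add_le s u (-v)

theorem mixedNorm_le_of_isUnitVec {s : ℕ} (hs : 1 ≤ s) {v : Fin p → ℝ} (hv : IsUnitVec v) {c : ℝ}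
    (h : l1norm v ≤ c * √(s : ℝ)) : mixedNorm s v ≤ 1 + c := by
  have hs' : 0 < √(s : ℝ) := Real.sqrt_pos.2 (by exact_mod_cast hs)
  have h1 : l2norm v = 1 := by rw [l2norm, hv, Real.sqrt_one]
  have h2 : l1norm v / √(s : ℝ) ≤ c := (div_le_iff₀ hs').2 h
  rw [mixedNorm, h1]; linarith

/-- Cauchy-Schwarz on the support of a sparse vector. -/
theorem sum_support_le (ξ v : Fin p → ℝ) :
    ∑ i ∈ Finset.univ.filter (fun i => ξ i ≠ 0), |v i| ≤ √(l0norm ξ : ℝ) * l2norm v := by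
  have hcard : ((Finset.univ.filter (fun i => ξ i ≠ 0)).card : ℝ) = l0norm ξ := by
    rw [l0norm, Set.ncard_eq_toFinset_card']
    congr 2
    ext; simp
  have h := sq_sum_le_card_mul_sum_sq (s := Finset.univ.filter (fun i => ξ i ≠ 0))
    (f := fun i => |v i|)
  have h2 : ∑ i ∈ Finset.univ.filter (fun i => ξ i ≠ 0), |v i| ^ 2 ≤ v ⬝ᵥ v := by
    simp only [sq_abs, dotProduct, ← pow_two]
    exact Finset.sum_le_univ_sum_of_nonneg fun i => sq_nonneg _
  rw [l2norm, ← Real.sqrt_mul (Nat.cast_nonneg _)]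
  apply Real.le_sqrt_of_sq_le
  refine h.trans ?_
  rw [← hcard]
  exact mul_le_mul_of_nonneg_left h2 (Nat.cast_nonneg _)

theorem l1norm_le_sqrt_l0norm (ξ : Fin p → ℝ) : l1norm ξ ≤ √(l0norm ξ : ℝ) * l2norm ξ := by
  refine le_trans (le_of_eq ?_) (sum_support_le ξ ξ)
  unfold l1norm
  symm
  apply Finset.sum_subset (Finset.subset_univ _)
  intro i _ hi
  simpa using hi

/-- The cone condition for vectors whose `ℓ₁` norm exceeds that of a sparse vector by little. -/
theorem l1norm_sub_le_cone (ξ β : Fin p → ℝ) {B : ℝ} (h : l1norm β ≤ l1norm ξ + B) :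
    l1norm (β - ξ) ≤ 2 * √(l0norm ξ : ℝ) * l2norm (β - ξ) + B := by
  have hs := sum_support_le ξ (β - ξ)
  have key : l1norm (β - ξ) ≤ l1norm β - l1norm ξ
      + 2 * ∑ i ∈ Finset.univ.filter (fun i => ξ i ≠ 0), |(β - ξ) i| := by
    unfold l1norm
    rw [Finset.sum_filter, Finset.mul_sum, ← Finset.sum_sub_distrib, ← Finset.sum_add_distrib]
    -- The inequality holds coordinatewise: with equality off the support of ξ, by the triangle
    -- inequality on it.
    refine Finset.sum_le_sum fun i _ => ?_
    by_cases hi : ξ i = 0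
    · simp [hi]
    · have : |ξ i| ≤ |β i| + |β i - ξ i| := by
        have := abs_sub_abs_le_abs_sub (ξ i) (β i)
        rw [abs_sub_comm] at this
        linarith
      simp only [ne_eq, hi, not_false_eq_true, if_true, Pi.sub_apply]
      linarith
  nlinarith

/-- The cone condition divided by √s: near ξ the mixed norm, which controls the noise, costs no more
than the Euclidean distance plus the normalized slack `b`. -/
theorem mixedNorm_sub_le_cone {ξ β : Fin p → ℝ} (hs : 1 ≤ l0norm ξ) {b : ℝ}
    (h : l1norm β ≤ l1norm ξ + b * √(l0norm ξ : ℝ)) :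
    mixedNorm (l0norm ξ) (β - ξ) ≤ 3 * l2norm (β - ξ) + b := by
  have hs' : 0 < √(l0norm ξ : ℝ) := Real.sqrt_pos.2 (by exact_mod_cast hs)
  have h1 := l1norm_sub_le_cone ξ β h
  have h2 : l1norm (β - ξ) / √(l0norm ξ : ℝ) ≤ 2 * l2norm (β - ξ) + b := by
    rw [div_le_iff₀ hs']; linarith
  unfold mixedNorm; linarith

end Norms

/-! ### The population pair and the Lyapunov function. -/

/-- The facts about the population pair `(S, Lam)` and its leading direction `ξ` with
eigenvalue `ρ` that the analysis of the algorithm uses. -/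
structure IsLeadingPair {p : ℕ} (M γ ρ : ℝ) (S Lam : Matrix (Fin p) (Fin p) ℝ)
    (ξ : Fin p → ℝ) : Prop where
  rho_pos : 0 < ρ
  unit : IsUnitVec ξ
  symm_S : ∀ u v, u ⬝ᵥ S *ᵥ v = v ⬝ᵥ S *ᵥ u
  symm_Lam : ∀ u v, u ⬝ᵥ Lam *ᵥ v = v ⬝ᵥ Lam *ᵥ u
  nonneg : ∀ u, 0 ≤ u ⬝ᵥ S *ᵥ u
  Lam_lower : ∀ u, u ⬝ᵥ u ≤ M * (u ⬝ᵥ Lam *ᵥ u)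
  Lam_upper : ∀ u, u ⬝ᵥ Lam *ᵥ u ≤ M * (u ⬝ᵥ u)
  le : ∀ u, u ⬝ᵥ S *ᵥ u ≤ ρ * (u ⬝ᵥ Lam *ᵥ u)
  eigen : ∀ u, u ⬝ᵥ S *ᵥ ξ = ρ * (u ⬝ᵥ Lam *ᵥ ξ)
  gap : ∀ u, IsUnitVec u →
    γ * (1 - (u ⬝ᵥ ξ) ^ 2) ≤ M * (u ⬝ᵥ Lam *ᵥ u - u ⬝ᵥ S *ᵥ u / ρ)

/-- The Lyapunov function `βᵀ (Lam - S / ρ) β`. -/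
noncomputable def excess {p : ℕ} (ρ : ℝ) (S Lam : Matrix (Fin p) (Fin p) ℝ) (β : Fin p → ℝ) : ℝ :=
  β ⬝ᵥ Lam *ᵥ β - β ⬝ᵥ S *ᵥ β / ρ

section Symmetric
variable {p : ℕ}

theorem quad_add {A : Matrix (Fin p) (Fin p) ℝ} (hA : ∀ u v, u ⬝ᵥ A *ᵥ v = v ⬝ᵥ A *ᵥ u)
    (u v : Fin p → ℝ) :
    (u + v) ⬝ᵥ A *ᵥ (u + v) = u ⬝ᵥ A *ᵥ u + 2 * (u ⬝ᵥ A *ᵥ v) + v ⬝ᵥ A *ᵥ v := by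
  rw [mulVec_add, add_dotProduct, dotProduct_add, dotProduct_add, hA v u]; ring

/-- Cauchy–Schwarz for a semidefinite form, from the discriminant of t ↦ (u + tv)ᵀA(u + tv). Besides
bounding the form of `S`, it turns maximality of ξ into an eigenvector equation when applied to ρΛ −
S. -/
theorem sq_bilin_le {A : Matrix (Fin p) (Fin p) ℝ} (hA : ∀ u v, u ⬝ᵥ A *ᵥ v = v ⬝ᵥ A *ᵥ u)
    (h0 : ∀ u, 0 ≤ u ⬝ᵥ A *ᵥ u) (u v : Fin p → ℝ) :
    (u ⬝ᵥ A *ᵥ v) ^ 2 ≤ (u ⬝ᵥ A *ᵥ u) * (v ⬝ᵥ A *ᵥ v) := by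
  have h : ∀ t : ℝ, 0 ≤ (v ⬝ᵥ A *ᵥ v) * (t * t) + (2 * (u ⬝ᵥ A *ᵥ v)) * t + u ⬝ᵥ A *ᵥ u := by
    intro t
    have := h0 (u + t • v)
    rw [quad_add hA] at this
    simp only [mulVec_smul, dotProduct_smul, smul_dotProduct, smul_eq_mul] at this
    linarith
  have := discrim_le_zero h
  unfold discrim at this
  nlinarith

end Symmetric

namespace IsLeadingPair
variable {p : ℕ} {M γ ρ : ℝ} {S Lam : Matrix (Fin p) (Fin p) ℝ} {ξ : Fin p → ℝ}

/-- The direction is determined only up to sign, so one may assume a non-negative inner product with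
the current iterate. -/
theorem neg (h : IsLeadingPair M γ ρ S Lam ξ) : IsLeadingPair M γ ρ S Lam (-ξ) where
  rho_pos := h.rho_pos
  unit := by have := h.unit; simpa [IsUnitVec] using this
  symm_S := h.symm_S
  symm_Lam := h.symm_Lam
  nonneg := h.nonneg
  Lam_lower := h.Lam_lower
  Lam_upper := h.Lam_upper
  le := h.le
  eigen u := by simp [mulVec_neg, h.eigen u]
  gap u hu := by simpa using h.gap u hu

theorem excess_nonneg (h : IsLeadingPair M γ ρ S Lam ξ) (u : Fin p → ℝ) :
    0 ≤ excess ρ S Lam u := by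
  have := (div_le_iff₀ h.rho_pos).2 ((h.le u).trans_eq (mul_comm _ _))
  unfold excess; linarith

theorem excess_le (h : IsLeadingPair M γ ρ S Lam ξ) (u : Fin p → ℝ) :
    excess ρ S Lam u ≤ M * (u ⬝ᵥ u) := by
  have := div_nonneg (h.nonneg u) h.rho_pos.le
  have := h.Lam_upper u
  unfold excess; linarith

/-- ξ lies in the kernel of Λ − S/ρ. Hence `excess` is quadratic in the distance to ξ. -/
theorem excess_sub (h : IsLeadingPair M γ ρ S Lam ξ) (u : Fin p → ℝ) :
    excess ρ S Lam (u - ξ) = excess ρ S Lam u := by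
  have e1 := quad_add h.symm_S u (-ξ)
  have e2 := quad_add h.symm_Lam u (-ξ)
  have e3 := h.eigen u
  have e4 := h.eigen ξ
  have := h.rho_pos.ne'
  simp only [mulVec_neg, dotProduct_neg, neg_dotProduct, neg_neg] at e1 e2
  unfold excess
  rw [sub_eq_add_neg u ξ, e1, e2, e3, e4]
  field_simp
  ring

theorem abs_bilin_S_le (h : IsLeadingPair M γ ρ S Lam ξ) (hM : 0 < M) {u β : Fin p → ℝ}
    (hβ : IsUnitVec β) : |u ⬝ᵥ S *ᵥ β| ≤ ρ * (M * l2norm u) := by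
  have hρ := h.rho_pos
  have hb : ∀ w, w ⬝ᵥ S *ᵥ w ≤ ρ * M * (w ⬝ᵥ w) := fun w => by
    have := mul_le_mul_of_nonneg_left (h.Lam_upper w) hρ.le
    linarith [h.le w]
  apply abs_le_of_sq_le_sq _ (by have := l2norm_nonneg u; positivity)
  refine (sq_bilin_le h.symm_S h.nonneg u β).trans ?_
  have h1 := hb u
  have h2 := hb β
  rw [hβ] at h2
  rw [← l2norm_sq] at h1
  calc _ ≤ (ρ * M * l2norm u ^ 2) * (ρ * M * 1) :=
        mul_le_mul h1 h2 (h.nonneg β) (by positivity)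
    _ = _ := by ring

end IsLeadingPair

/-! ### One step of the algorithm. -/

section Step
variable {p : ℕ}

/-- The competitor of the new iterate: move the fraction κ from β towards ξ and renormalize. The
norm `m` satisfies m² = 1 − κ(1 − κ)x, so normalization is a correction of order κx, and the squared
length of the move is κ²x to leading order. -/
theorem exists_interpolant {β ξ : Fin p → ℝ} (hβ : IsUnitVec β) (hξ : IsUnitVec ξ) {κ x : ℝ}
    (hκ : 0 ≤ κ) (hκ' : κ ≤ 1 / 8) (hx : (β - ξ) ⬝ᵥ (β - ξ) = x) (hx1 : x ≤ 1) :
    ∃ m : ℝ, 0 < m ∧ 1 - κ * x ≤ m ∧ m⁻¹ ≤ 1 + 2 * κ * x ∧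
      IsUnitVec (m⁻¹ • ((1 - κ) • β + κ • ξ)) ∧
      (m⁻¹ • ((1 - κ) • β + κ • ξ) - β) ⬝ᵥ (m⁻¹ • ((1 - κ) • β + κ • ξ) - β)
        ≤ κ ^ 2 * x * (1 + x / 2) := by
  unfold IsUnitVec at *
  have hx0 : 0 ≤ x := hx ▸ dotProduct_self_nonneg' _
  have hc : β ⬝ᵥ ξ = 1 - x / 2 := by
    simp only [sub_dotProduct, dotProduct_sub, hβ, hξ, dotProduct_comm ξ β] at hx
    linarith
  have hc' : ξ ⬝ᵥ β = 1 - x / 2 := by rw [dotProduct_comm, hc]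
  have hκx : κ * x ≤ 1 / 8 := by nlinarith
  have hκx0 : 0 ≤ κ * x := mul_nonneg hκ hx0
  set y := κ * (1 - κ) * x with hy
  have hy0 : 0 ≤ y := by have : 0 ≤ 1 - κ := by linarith
                         positivity
  have hyκ : y ≤ κ * x := by rw [hy]; nlinarith
  set m := √(1 - y) with hm
  have hm2 : m ^ 2 = 1 - y := Real.sq_sqrt (by linarith)
  have hmpos : 0 < m := Real.sqrt_pos.2 (by linarith)
  have hm1 : m ≤ 1 := by nlinarith
  have hml : 1 - κ * x ≤ m := by nlinarith
  have hinv : 1 + y / 2 ≤ m⁻¹ := by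
    rw [le_inv_comm₀ (by positivity) hmpos, ← one_div, le_div_iff₀ (by positivity)]
    have h1 : (m * (1 + y / 2)) ^ 2 ≤ 1 := by
      rw [mul_pow, hm2]; nlinarith [pow_nonneg hy0 3, sq_nonneg y]
    nlinarith [mul_pos hmpos (show 0 < 1 + y / 2 by linarith)]
  have hww : ((1 - κ) • β + κ • ξ) ⬝ᵥ ((1 - κ) • β + κ • ξ) = m ^ 2 := by
    simp only [add_dotProduct, dotProduct_add, smul_dotProduct, dotProduct_smul, smul_eq_mul,
      hβ, hξ, hc, hc', hm2, hy]
    ring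
  have hzz : (m⁻¹ • ((1 - κ) • β + κ • ξ)) ⬝ᵥ (m⁻¹ • ((1 - κ) • β + κ • ξ)) = 1 := by
    rw [smul_dotProduct, dotProduct_smul, hww]
    simp only [smul_eq_mul]
    field_simp
  refine ⟨m, hmpos, hml, ?_, hzz, ?_⟩
  · rw [inv_le_comm₀ hmpos (by positivity), ← one_div, div_le_iff₀ (by positivity)]
    nlinarith
  · have hzβ : (m⁻¹ • ((1 - κ) • β + κ • ξ)) ⬝ᵥ β = m⁻¹ * (1 - κ * x / 2) := by
      simp only [add_dotProduct, smul_dotProduct, smul_eq_mul, hβ, hc']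
      ring
    rw [sub_dotProduct, dotProduct_sub, dotProduct_sub, hzz, dotProduct_comm β, hzβ, hβ]
    have h1 : (1 + y / 2) * (1 - κ * x / 2) ≤ m⁻¹ * (1 - κ * x / 2) :=
      mul_le_mul_of_nonneg_right hinv (by linarith)
    have h2 : 1 - κ ^ 2 * x / 2 - κ ^ 2 * x ^ 2 / 4 ≤ (1 + y / 2) * (1 - κ * x / 2) := by
      have : 0 ≤ κ ^ 3 * x ^ 2 := by positivity
      rw [hy]; nlinarith
    linarith

theorem dotProduct_proxTarget {Sh Lh : Matrix (Fin p) (Fin p) ℝ} {β : Fin p → ℝ} {η : ℝ}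
    (hf : rayleigh Sh Lh β ≠ 0) (u : Fin p → ℝ) :
    u ⬝ᵥ proxTarget Sh Lh η β
      = u ⬝ᵥ β + η * ((u ⬝ᵥ Sh *ᵥ β) / rayleigh Sh Lh β - u ⬝ᵥ Lh *ᵥ β) := by
  unfold proxTarget
  rw [dotProduct_add, dotProduct_smul, sub_mulVec, smul_mulVec, dotProduct_sub, dotProduct_smul]
  simp only [smul_eq_mul]
  field_simp

/-- A minimizer of the distance to `θ` over unit vectors maximizes the inner product with `θ`. -/
theorem dotProduct_le_of_isMinOn {F : Set (Fin p → ℝ)} {θ b z : Fin p → ℝ}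
    (hmin : IsMinOn (fun b => (b - θ) ⬝ᵥ (b - θ)) F b) (hz : z ∈ F) (hbu : IsUnitVec b)
    (hzu : IsUnitVec z) : z ⬝ᵥ θ ≤ b ⬝ᵥ θ := by
  have h := hmin hz
  unfold IsUnitVec at *
  simp only [Set.mem_ofPred_eq, sub_dotProduct, dotProduct_sub, hbu, hzu, dotProduct_comm θ] at h
  linarith

/-- The gradient step of the empirical objective deviates little from the gradient step of the
population objective. -/
theorem abs_gradient_error_le {s : ℕ} {M γ ρ K r K₁ : ℝ} {S Lam Sh Lh : Matrix (Fin p) (Fin p) ℝ}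
    {ξ β : Fin p → ℝ} (h : IsLeadingPair M γ ρ S Lam ξ) (hM : 0 < M) (hK : 0 ≤ K) (hr : 0 ≤ r)
    (hS : ∀ u v, |u ⬝ᵥ Sh *ᵥ v - u ⬝ᵥ S *ᵥ v| ≤ ρ * (K * r * mixedNorm s u * mixedNorm s v))
    (hL : ∀ u v, |u ⬝ᵥ Lh *ᵥ v - u ⬝ᵥ Lam *ᵥ v| ≤ K * r * mixedNorm s u * mixedNorm s v)
    (hβ : IsUnitVec β) (hK₁ : mixedNorm s β ≤ K₁)
    (hsmall : 2 * K * K₁ ^ 2 * r ≤ 1 / (4 * M)) (hQ : excess ρ S Lam β ≤ 1 / (4 * M)) :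
    rayleigh Sh Lh β ≠ 0 ∧ ∀ u, |(u ⬝ᵥ Sh *ᵥ β) / rayleigh Sh Lh β - u ⬝ᵥ Lh *ᵥ β
        + u ⬝ᵥ Lam *ᵥ β - u ⬝ᵥ S *ᵥ β / ρ|
      ≤ 3 * K * K₁ * r * mixedNorm s u
        + 2 * M * (excess ρ S Lam β + 2 * K * K₁ ^ 2 * r) * (M * l2norm u) := by
  have hρ := h.rho_pos
  have hN := mixedNorm_nonneg s β
  have hK₁0 : 0 ≤ K₁ := hN.trans hK₁
  set Q := excess ρ S Lam β with hQdef
  have hQ0 : 0 ≤ Q := h.excess_nonneg β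
  set a := β ⬝ᵥ Lam *ᵥ β with ha
  have ha1 : 1 / M ≤ a := by
    have := h.Lam_lower β
    rw [hβ] at this
    rw [div_le_iff₀ hM]; linarith
  set E := K * K₁ ^ 2 * r with hE
  have hE0 : 0 ≤ E := by positivity
  have hbb : K * r * mixedNorm s β * mixedNorm s β ≤ E := by
    have : mixedNorm s β * mixedNorm s β ≤ K₁ ^ 2 := by rw [← pow_two]; gcongr
    calc _ = K * r * (mixedNorm s β * mixedNorm s β) := by ring
      _ ≤ K * r * K₁ ^ 2 := by gcongr
      _ = E := by rw [hE]; ring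
  -- `e₁` and `e₂` are the noise in the numerator (relative to ρ) and in the denominator of the
  -- empirical quotient.
  obtain ⟨e₁, he₁⟩ : ∃ e₁, e₁ = (β ⬝ᵥ Sh *ᵥ β - β ⬝ᵥ S *ᵥ β) / ρ := ⟨_, rfl⟩
  obtain ⟨e₂, he₂⟩ : ∃ e₂, e₂ = β ⬝ᵥ Lh *ᵥ β - β ⬝ᵥ Lam *ᵥ β := ⟨_, rfl⟩
  have h1 : |e₁| ≤ E := by
    rw [he₁, abs_div, abs_of_pos hρ, div_le_iff₀ hρ]
    refine (hS β β).trans ?_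
    rw [mul_comm]; gcongr
  have h2 : |e₂| ≤ E := by rw [he₂]; exact (hL β β).trans hbb
  obtain ⟨h1a, h1b⟩ := abs_le.1 h1
  obtain ⟨h2a, h2b⟩ := abs_le.1 h2
  have hnum : β ⬝ᵥ Sh *ᵥ β = ρ * (a - Q + e₁) := by
    rw [hQdef, excess, he₁, ← ha]; field_simp; ring
  have hden : β ⬝ᵥ Lh *ᵥ β = a + e₂ := by rw [he₂, ← ha]; ring
  have hMM : 1 / M = 4 * (1 / (4 * M)) := by field_simp
  have hq : 0 < 1 / (4 * M) := by positivity
  have hhalf : 1 / (2 * M) = 2 * (1 / (4 * M)) := by field_simp; norm_num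
  have hd1 : 1 / (2 * M) ≤ a - Q + e₁ := by linarith
  have hd1' : 0 < a - Q + e₁ := by linarith
  have hd2 : 0 < a + e₂ := by linarith
  have hf : rayleigh Sh Lh β = ρ * (a - Q + e₁) / (a + e₂) := by rw [rayleigh, hnum, hden]
  refine ⟨by rw [hf]; positivity, fun u => ?_⟩
  -- 1 + τ is the ratio of ρ to the empirical quotient. Even without noise τ is of order Q, because
  -- the quotient at β lies below ρ; this is the source of the Q‖u‖₂ term.
  obtain ⟨τ, hτ⟩ : ∃ τ, τ = (Q + e₂ - e₁) / (a - Q + e₁) := ⟨_, rfl⟩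
  have hτle : |τ| ≤ 2 * M * (Q + 2 * E) := by
    rw [hτ, abs_div, abs_of_pos hd1', div_le_iff₀ hd1']
    have h3 : |Q + e₂ - e₁| ≤ Q + 2 * E := abs_le.2 ⟨by linarith, by linarith⟩
    have h4 : 1 ≤ 2 * M * (a - Q + e₁) := by
      rw [div_le_iff₀ (by positivity)] at hd1; linarith
    linarith [mul_le_mul_of_nonneg_right h4 (show 0 ≤ Q + 2 * E by linarith)]
  have hτ1 : |τ| ≤ 1 := by
    refine hτle.trans ?_
    have : Q + 2 * E ≤ 1 / (2 * M) := by rw [hhalf]; linarith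
    rw [le_div_iff₀ (by positivity)] at this
    linarith
  have hexp : (u ⬝ᵥ Sh *ᵥ β) / rayleigh Sh Lh β - u ⬝ᵥ Lh *ᵥ β + u ⬝ᵥ Lam *ᵥ β - u ⬝ᵥ S *ᵥ β / ρ
      = (1 + τ) * ((u ⬝ᵥ Sh *ᵥ β - u ⬝ᵥ S *ᵥ β) / ρ) + τ * (u ⬝ᵥ S *ᵥ β / ρ)
        - (u ⬝ᵥ Lh *ᵥ β - u ⬝ᵥ Lam *ᵥ β) := by
    have hτ' : 1 + τ = (a + e₂) / (a - Q + e₁) := by rw [hτ]; field_simp; ring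
    have : (u ⬝ᵥ Sh *ᵥ β) / rayleigh Sh Lh β = (1 + τ) * ((u ⬝ᵥ Sh *ᵥ β) / ρ) := by
      rw [hτ', hf]; field_simp
    rw [this]; ring
  rw [hexp]
  have hNu := mixedNorm_nonneg s u
  have hKb : K * r * mixedNorm s u * mixedNorm s β ≤ K * K₁ * r * mixedNorm s u := by
    calc _ ≤ K * r * mixedNorm s u * K₁ := by gcongr
      _ = _ := by ring
  have hA : |(u ⬝ᵥ Sh *ᵥ β - u ⬝ᵥ S *ᵥ β) / ρ| ≤ K * K₁ * r * mixedNorm s u := by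
    rw [abs_div, abs_of_pos hρ, div_le_iff₀ hρ]
    refine (hS u β).trans ?_
    rw [mul_comm]; gcongr
  have hB : |u ⬝ᵥ S *ᵥ β / ρ| ≤ M * l2norm u := by
    rw [abs_div, abs_of_pos hρ, div_le_iff₀ hρ]
    linarith [h.abs_bilin_S_le hM (u := u) hβ]
  have hC := (hL u β).trans hKb
  have h1τ : |1 + τ| ≤ 2 := by
    have := abs_le.1 hτ1
    exact abs_le.2 ⟨by linarith, by linarith⟩
  refine (abs_sub _ _).trans ?_
  have hX : |(1 + τ) * ((u ⬝ᵥ Sh *ᵥ β - u ⬝ᵥ S *ᵥ β) / ρ)|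
      ≤ 2 * (K * K₁ * r * mixedNorm s u) := by
    rw [abs_mul]
    exact mul_le_mul h1τ hA (abs_nonneg _) (by norm_num)
  have hY : |τ * (u ⬝ᵥ S *ᵥ β / ρ)| ≤ 2 * M * (Q + 2 * E) * (M * l2norm u) := by
    rw [abs_mul]
    exact mul_le_mul hτle hB (abs_nonneg _) (by positivity)
  have hXY := abs_add_le ((1 + τ) * ((u ⬝ᵥ Sh *ᵥ β - u ⬝ᵥ S *ᵥ β) / ρ)) (τ * (u ⬝ᵥ S *ᵥ β / ρ))
  have hEE : 2 * K * K₁ ^ 2 * r = 2 * E := by rw [hE]; ring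
  rw [hEE]
  linarith

/-- The change of the Lyapunov function in one step, compared with an arbitrary competitor
`z = a β + a' ξ` of the new iterate `b`. -/
theorem excess_descent {M γ ρ η g a a' : ℝ} {S Lam : Matrix (Fin p) (Fin p) ℝ}
    {ξ β b z : Fin p → ℝ} (h : IsLeadingPair M γ ρ S Lam ξ) (hη : 0 < η)
    (hβ : IsUnitVec β) (hb : IsUnitVec b) (hz : IsUnitVec z) (hza : z = a • β + a' • ξ)
    (hstep : η * ((b - z) ⬝ᵥ Lam *ᵥ β - (b - z) ⬝ᵥ S *ᵥ β / ρ - g) ≤ (b - z) ⬝ᵥ β) :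
    excess ρ S Lam b ≤ -excess ρ S Lam β + 2 * a * excess ρ S Lam β
      + (z - β) ⬝ᵥ (z - β) / η + 2 * g - (1 / η - M) * ((b - β) ⬝ᵥ (b - β)) := by
  have hρ := h.rho_pos.ne'
  have hup := h.excess_le (b - β)
  -- The ξ-component of `z` contributes nothing, as ξ is in the kernel of the form.
  have hLz : z ⬝ᵥ Lam *ᵥ β - z ⬝ᵥ S *ᵥ β / ρ = a * excess ρ S Lam β := by
    have e1 : ξ ⬝ᵥ S *ᵥ β = ρ * (ξ ⬝ᵥ Lam *ᵥ β) := by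
      rw [h.symm_S, h.symm_Lam ξ, h.eigen]
    rw [hza, add_dotProduct, add_dotProduct, smul_dotProduct, smul_dotProduct, smul_dotProduct,
      smul_dotProduct, e1, excess]
    simp only [smul_eq_mul]
    field_simp
    ring
  have hbS := quad_add h.symm_S b (-β)
  have hbL := quad_add h.symm_Lam b (-β)
  simp only [mulVec_neg, dotProduct_neg, neg_dotProduct, neg_neg, ← sub_eq_add_neg] at hbS hbL
  have hexb : excess ρ S Lam (b - β) = excess ρ S Lam b
      - 2 * (b ⬝ᵥ Lam *ᵥ β - b ⬝ᵥ S *ᵥ β / ρ) + excess ρ S Lam β := by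
    unfold excess; rw [hbS, hbL]; ring
  have hdb : (b - β) ⬝ᵥ (b - β) = 2 - 2 * (b ⬝ᵥ β) := by
    unfold IsUnitVec at *
    simp only [sub_dotProduct, dotProduct_sub, hb, hβ, dotProduct_comm β b]; ring
  have hdz : (z - β) ⬝ᵥ (z - β) = 2 - 2 * (z ⬝ᵥ β) := by
    unfold IsUnitVec at *
    simp only [sub_dotProduct, dotProduct_sub, hz, hβ, dotProduct_comm β z]; ring
  rw [sub_dotProduct, sub_dotProduct, sub_dotProduct] at hstep
  have hstep' : 2 * (b ⬝ᵥ Lam *ᵥ β - b ⬝ᵥ S *ᵥ β / ρ) ≤ 2 * (a * excess ρ S Lam β) + 2 * g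
      + ((z - β) ⬝ᵥ (z - β) - (b - β) ⬝ᵥ (b - β)) / η := by
    -- For unit vectors, 2(b − z)ᵀβ = ‖z − β‖² − ‖b − β‖².
    rw [← hLz, hdb, hdz, ← sub_le_iff_le_add', le_div_iff₀ hη]
    rw [sub_div] at hstep
    linarith
  rw [sub_div] at hstep'
  have : (1 / η - M) * ((b - β) ⬝ᵥ (b - β)) = (b - β) ⬝ᵥ (b - β) / η - M * ((b - β) ⬝ᵥ (b - β)) := by
    ring
  rw [this]
  linarith

end Step
-- Young's inequality with a budget: the two products containing `d` (step length) are absorbed by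
-- `w * d ^ 2`, and four terms, each at most c₀κQ/4, use up the part c₀ of the contraction. The
-- remaining r² is at most rb/k, since the slack `b` is at least `k * r`.
theorem contraction_of_noise_bound {κ c₀ g C₁ C₂ k Q Q' y d r b w : ℝ} (hκ : 0 < κ) (hc₀ : 0 < c₀)
    (hg : 0 < g) (hC₁ : 0 < C₁) (hC₂ : 0 < C₂) (hk : 0 < k) (hQ : 0 ≤ Q)
    (hr : 0 ≤ r) (hy : y ^ 2 ≤ g * Q) (hq₁ : g * Q ≤ (c₀ * κ / (4 * C₂)) ^ 2)
    (hq₂ : 5 * g * Q ≤ c₀ / 4) (hq₃ : C₂ ^ 2 * Q ≤ c₀ * κ / 4) (hkr : k * r ≤ b) (hw : 2 ≤ w)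
    (h : Q' ≤ (1 - κ) * Q + 5 * κ * y ^ 2 * Q + (C₁ * r * (d + y + b) + C₂ * Q * (d + y))
      - w * d ^ 2) :
    Q' ≤ (1 - (1 - c₀) * κ) * Q + (C₁ ^ 2 * (1 + g / (c₀ * κ)) / k + C₁) * r * b := by
  have hcκ : 0 < c₀ * κ := mul_pos hc₀ hκ
  have hyle : y ≤ c₀ * κ / (4 * C₂) :=
    (abs_le_of_sq_le_sq' (hy.trans hq₁) (by positivity)).2
  have t1 : C₁ * r * d ≤ d ^ 2 + C₁ ^ 2 * r ^ 2 := by nlinarith [sq_nonneg (d - C₁ * r), sq_nonneg d]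
  have t2 : C₂ * Q * d ≤ d ^ 2 + C₂ ^ 2 * Q ^ 2 := by nlinarith [sq_nonneg (d - C₂ * Q), sq_nonneg d]
  have t3 : C₁ * r * y ≤ c₀ * κ / 4 * Q + C₁ ^ 2 * (g / (c₀ * κ)) * r ^ 2 := by
    have e : C₁ * r * y ≤ c₀ * κ / (4 * g) * y ^ 2 + C₁ ^ 2 * (g / (c₀ * κ)) * r ^ 2 := by
      have : 0 ≤ c₀ * κ / (4 * g) * (y - 2 * g * C₁ * r / (c₀ * κ)) ^ 2 := by positivity
      have e2 : c₀ * κ / (4 * g) * (y - 2 * g * C₁ * r / (c₀ * κ)) ^ 2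
          = c₀ * κ / (4 * g) * y ^ 2 - C₁ * r * y + C₁ ^ 2 * (g / (c₀ * κ)) * r ^ 2 := by
        field_simp; ring
      linarith
    have e3 : c₀ * κ / (4 * g) * y ^ 2 ≤ c₀ * κ / (4 * g) * (g * Q) := by gcongr
    have e4 : c₀ * κ / (4 * g) * (g * Q) = c₀ * κ / 4 * Q := by field_simp
    linarith
  have t4 : C₂ * Q * y ≤ c₀ * κ / 4 * Q := by
    calc C₂ * Q * y ≤ C₂ * Q * (c₀ * κ / (4 * C₂)) := by gcongr
      _ = _ := by field_simp
  have t5 : 5 * κ * y ^ 2 * Q ≤ c₀ * κ / 4 * Q := by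
    have : 5 * κ * y ^ 2 ≤ c₀ * κ / 4 := by nlinarith
    exact mul_le_mul_of_nonneg_right this hQ
  have t6 : C₂ ^ 2 * Q ^ 2 ≤ c₀ * κ / 4 * Q := by
    calc _ = C₂ ^ 2 * Q * Q := by ring
      _ ≤ _ := mul_le_mul_of_nonneg_right hq₃ hQ
  have t7 : 2 * d ^ 2 ≤ w * d ^ 2 := by gcongr
  have t8 : r ^ 2 ≤ r * b / k := by rw [le_div_iff₀ hk]; nlinarith
  have t9 : C₁ ^ 2 * (1 + g / (c₀ * κ)) * r ^ 2 ≤ C₁ ^ 2 * (1 + g / (c₀ * κ)) * (r * b / k) := by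
    gcongr
  have e : (C₁ ^ 2 * (1 + g / (c₀ * κ)) / k + C₁) * r * b
      = C₁ ^ 2 * (1 + g / (c₀ * κ)) * (r * b / k) + C₁ * r * b := by ring
  rw [e]
  linarith

theorem l0norm_neg {p : ℕ} (v : Fin p → ℝ) : l0norm (-v) = l0norm v := by simp [l0norm]

/-- One step of the algorithm from a vector that has a non-negative inner product with the
leading direction. -/
theorem excess_step_of_nonneg {p : ℕ} {M γ c₀ η c₁ K k q₀ κ g C₁ C₂ ρ r b L' : ℝ}
    {S Lam Sh Lh : Matrix (Fin p) (Fin p) ℝ} {ξ β β' : Fin p → ℝ}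
    (hM : 1 ≤ M) (hγ : 0 < γ) (hγ1 : γ ≤ 1) (hc₀ : 0 < c₀) (hη : 0 < η)
    (hηM : 8 * M * η ≤ 1) (hc₁ : 0 < c₁) (hK : 0 < K) (hk : 0 < k)
    (hκ : κ = η * γ / M) (hg : g = 2 * M / γ)
    (hC₁ : C₁ = 54 * K * (2 + c₁) + 8 * M ^ 2 * K * (2 + c₁) ^ 2) (hC₂ : C₂ = 4 * M ^ 2)
    (hq₁ : g * q₀ ≤ (c₀ * κ / (4 * C₂)) ^ 2) (hq₂ : 5 * g * q₀ ≤ c₀ / 4)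
    (hq₃ : C₂ ^ 2 * q₀ ≤ c₀ * κ / 4) (hq₄ : q₀ ≤ 1 / (4 * M)) (hq₅ : g * q₀ ≤ 1)
    (hq₆ : g * q₀ * (1 + c₁) ≤ 3 / 4) (hr₀ : 2 * K * (2 + c₁) ^ 2 * r ≤ 1 / (4 * M))
    (h : IsLeadingPair M γ ρ S Lam ξ) (hs : 1 ≤ l0norm ξ)
    (hS : ∀ u v, |u ⬝ᵥ Sh *ᵥ v - u ⬝ᵥ S *ᵥ v|
      ≤ ρ * (K * r * mixedNorm (l0norm ξ) u * mixedNorm (l0norm ξ) v))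
    (hL : ∀ u v, |u ⬝ᵥ Lh *ᵥ v - u ⬝ᵥ Lam *ᵥ v|
      ≤ K * r * mixedNorm (l0norm ξ) u * mixedNorm (l0norm ξ) v)
    (hr : 0 ≤ r) (hkr : k * r ≤ b)
    (hβ : IsUnitVec β) (hβ1 : l1norm β ≤ l1norm ξ + b * √(l0norm ξ : ℝ))
    (hb : l1norm ξ + b * √(l0norm ξ : ℝ) ≤ (1 + c₁) * √(l0norm ξ : ℝ))
    (hL' : L' ≤ l1norm ξ + b * √(l0norm ξ : ℝ))
    (hL'' : l1norm ξ + (1 - κ / 4) * b * √(l0norm ξ : ℝ) ≤ L')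
    (hQ : excess ρ S Lam β ≤ q₀) (hQb : excess ρ S Lam β ≤ q₀ * b)
    (hβ' : β' ∈ feasible p L')
    (hmin : IsMinOn (fun b => (b - proxTarget Sh Lh η β) ⬝ᵥ (b - proxTarget Sh Lh η β))
      (feasible p L') β')
    (hsign : 0 ≤ β ⬝ᵥ ξ) :
    excess ρ S Lam β' ≤ (1 - (1 - c₀) * κ) * excess ρ S Lam β
      + (C₁ ^ 2 * (1 + g / (c₀ * κ)) / k + C₁) * r * b := by
  have hM0 : 0 < M := by linarith
  have hκ0 : 0 < κ := by rw [hκ]; positivity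
  have hg0 : 0 < g := by rw [hg]; positivity
  have hC₁0 : 0 < C₁ := by rw [hC₁]; positivity
  have hC₂0 : 0 < C₂ := by rw [hC₂]; positivity
  have hη8 : η ≤ 1 / 8 := by linarith [mul_le_mul_of_nonneg_right hM hη.le]
  have hκ8 : κ ≤ 1 / 8 := by
    rw [hκ, div_le_iff₀ hM0]; linarith [mul_le_mul_of_nonneg_left hγ1 hη.le]
  have hb0 : 0 ≤ b := le_trans (by positivity) hkr
  have hs' : 0 < √(l0norm ξ : ℝ) := Real.sqrt_pos.2 (by exact_mod_cast hs)
  set σ := √(l0norm ξ : ℝ) with hσ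
  have hQ0 := h.excess_nonneg β
  have hgap := h.gap β hβ
  change _ ≤ M * excess ρ S Lam β at hgap
  set Q := excess ρ S Lam β with hQdef
  obtain ⟨x, hx⟩ : ∃ x, (β - ξ) ⬝ᵥ (β - ξ) = x := ⟨_, rfl⟩
  have hx0 : 0 ≤ x := hx ▸ dotProduct_self_nonneg' _
  have hcx : β ⬝ᵥ ξ = 1 - x / 2 := by
    have h1 := h.unit
    have hx' := hx
    unfold IsUnitVec at hβ h1
    simp only [sub_dotProduct, dotProduct_sub, hβ, h1, dotProduct_comm ξ β] at hx'
    linarith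
  have hx2 : x ≤ 2 := by rw [hcx] at hsign; linarith
  rw [hcx] at hgap
  -- The eigengap in terms of the squared distance x: 1 − (1 − x/2)² = x − x²/4.
  have hxQ' : x - x ^ 2 / 4 ≤ M / γ * Q := by
    rw [div_mul_eq_mul_div, le_div_iff₀ hγ]; linarith
  have hxQ : x ≤ g * Q := by
    have : g * Q = 2 * (M / γ * Q) := by rw [hg]; ring
    rw [this]; linarith [mul_nonneg hx0 (sub_nonneg.2 hx2)]
  have hx1 : x ≤ 1 := hxQ.trans (le_trans (by gcongr) hq₅)
  obtain ⟨m, hm, hml, hmi, hzu, hzd⟩ := exists_interpolant hβ h.unit hκ0.le hκ8 hx hx1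
  set z := m⁻¹ • ((1 - κ) • β + κ • ξ) with hz
  -- Before normalization the slack is (1 − κ)bσ, while `L'` allows (1 − κ/4)bσ. The difference
  -- 3κbσ/4 pays for the normalization loss κxL'; this is where Q ≤ q₀b is needed.
  have hz1 : l1norm z ≤ L' := by
    have e1 : l1norm ((1 - κ) • β + κ • ξ) ≤ (1 - κ) * l1norm β + κ * l1norm ξ := by
      refine (l1norm_add_le _ _).trans ?_
      rw [l1norm_smul, l1norm_smul, abs_of_nonneg (by linarith), abs_of_nonneg hκ0.le]
    rw [hz, l1norm_smul, abs_of_pos (inv_pos.2 hm), inv_mul_le_iff₀ hm]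
    have hL'0 : 0 ≤ L' := (l1norm_nonneg _).trans hβ'.2
    have e2 : (1 - κ) * l1norm β ≤ (1 - κ) * (l1norm ξ + b * σ) := by
      apply mul_le_mul_of_nonneg_left hβ1; linarith
    have e3 : (1 - κ * x) * L' ≤ m * L' := by gcongr
    have e4 : κ * x * L' ≤ κ * (3 / 4 * b * σ) := by
      have : x * L' ≤ 3 / 4 * b * σ := by
        calc x * L' ≤ (g * (q₀ * b)) * ((1 + c₁) * σ) := by
              apply mul_le_mul (hxQ.trans (by gcongr)) (hL'.trans hb) hL'0
              exact (hx0.trans hxQ).trans (by gcongr)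
          _ = (g * q₀ * (1 + c₁)) * (b * σ) := by ring
          _ ≤ 3 / 4 * (b * σ) := by gcongr
          _ = _ := by ring
      rw [mul_assoc]
      gcongr
    linarith
  have hzF : z ∈ feasible p L' := ⟨hzu, hz1⟩
  have hinner := dotProduct_le_of_isMinOn hmin hzF hβ'.1 hzu
  have hξ1 : l1norm β ≤ (1 + c₁) * σ := hβ1.trans hb
  have hNβ : mixedNorm (l0norm ξ) β ≤ 2 + c₁ := by
    have := mixedNorm_le_of_isUnitVec hs hβ hξ1
    linarith
  obtain ⟨hf, hgrad⟩ := abs_gradient_error_le h hM0 hK.le hr hS hL hβ hNβ hr₀ (hQ.trans hq₄)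
  have hgu := hgrad (β' - z)
  set G := 3 * K * (2 + c₁) * r * mixedNorm (l0norm ξ) (β' - z)
    + 2 * M * (excess ρ S Lam β + 2 * K * (2 + c₁) ^ 2 * r) * (M * l2norm (β' - z)) with hG
  have hstep : η * ((β' - z) ⬝ᵥ Lam *ᵥ β - (β' - z) ⬝ᵥ S *ᵥ β / ρ - G) ≤ (β' - z) ⬝ᵥ β := by
    have e1 : 0 ≤ (β' - z) ⬝ᵥ proxTarget Sh Lh η β := by rw [sub_dotProduct]; linarith
    rw [dotProduct_proxTarget hf] at e1
    have e2 := mul_le_mul_of_nonneg_left (abs_le.1 hgu).2 hη.le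
    linarith
  have hza : z = (m⁻¹ * (1 - κ)) • β + (m⁻¹ * κ) • ξ := by
    rw [hz, smul_add, smul_smul, smul_smul]
  have hdesc := excess_descent h hη hβ hβ'.1 hzu hza hstep
  obtain ⟨y, hy⟩ : ∃ y, y = l2norm (β - ξ) := ⟨_, rfl⟩
  obtain ⟨d, hd⟩ : ∃ d, d = l2norm (β' - β) := ⟨_, rfl⟩
  have hy2 : y ^ 2 = x := by rw [hy, l2norm_sq, hx]
  have hd2 : (β' - β) ⬝ᵥ (β' - β) = d ^ 2 := by rw [hd, l2norm_sq]
  have hy0 : 0 ≤ y := hy ▸ l2norm_nonneg _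
  have hd0 : 0 ≤ d := hd ▸ l2norm_nonneg _
  have hzy : l2norm (z - β) ≤ y := by
    apply abs_le_of_sq_le_sq' _ hy0 |>.2
    rw [l2norm_sq, hy2]
    refine hzd.trans ?_
    have : κ ^ 2 * (1 + x / 2) ≤ (1 / 8) ^ 2 * (1 + 1 / 2) := by gcongr
    linarith [mul_le_mul_of_nonneg_left this hx0]
  have hbξ : l2norm (β' - ξ) ≤ d + y := by
    have := l2norm_add_le (β' - β) (β - ξ)
    rw [sub_add_sub_cancel] at this
    linarith
  have hzξ : l2norm (z - ξ) ≤ 2 * y := by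
    have := l2norm_add_le (z - β) (β - ξ)
    rw [sub_add_sub_cancel] at this
    linarith
  -- Both `β'` and `z` are feasible, so both lie in the cone around ξ.
  have hNu : mixedNorm (l0norm ξ) (β' - z) ≤ 3 * d + 9 * y + 2 * b := by
    have e1 := mixedNorm_sub_le_cone hs (hβ'.2.trans hL')
    have e2 := mixedNorm_sub_le_cone hs (hz1.trans hL')
    have e3 := mixedNorm_sub_le (l0norm ξ) (β' - ξ) (z - ξ)
    rw [sub_sub_sub_cancel_right] at e3
    linarith
  have hlu : l2norm (β' - z) ≤ d + y := by
    have := l2norm_sub_le (β' - β) (z - β)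
    rw [sub_sub_sub_cancel_right] at this
    linarith
  have hG2 : 2 * G ≤ C₁ * r * (d + y + b) + C₂ * Q * (d + y) := by
    have e1 : G ≤ 3 * K * (2 + c₁) * r * (3 * d + 9 * y + 2 * b)
        + 2 * M * (Q + 2 * K * (2 + c₁) ^ 2 * r) * (M * (d + y)) := by
      rw [hG]; gcongr
    have e2 : 0 ≤ K * (2 + c₁) * r * d := by positivity
    have e3 : 0 ≤ K * (2 + c₁) * r * b := by positivity
    have e4 : 0 ≤ M ^ 2 * K * (2 + c₁) ^ 2 * r * b := by positivity
    rw [hC₁, hC₂]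
    linarith
  have hw : 2 ≤ 1 / η - M := by
    rw [le_sub_iff_add_le, le_div_iff₀ hη]; linarith
  refine contraction_of_noise_bound hκ0 hc₀ hg0 hC₁0 hC₂0 hk hQ0 hr (hy2 ▸ hxQ)
    (le_trans (by gcongr) hq₁) (le_trans (by gcongr) hq₂) (le_trans (by gcongr) hq₃) hkr hw ?_
    (d := d)
  rw [hy2]
  -- The leading terms are −Q + 2(1 − κ)Q + κQ = (1 − κ)Q: moving towards ξ gains 2κQ and costs
  -- κ²x/η, which is κQ to leading order. The value κ = ηγ/M optimizes this trade-off.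
  have f1 : 2 * (m⁻¹ * (1 - κ)) * Q ≤ 2 * (1 - κ) * Q + 4 * κ * x * Q := by
    have e1 : m⁻¹ * (1 - κ) ≤ (1 + 2 * κ * x) * (1 - κ) := by
      apply mul_le_mul_of_nonneg_right hmi; linarith
    have e2 : (1 + 2 * κ * x) * (1 - κ) ≤ (1 - κ) + 2 * κ * x := by
      linarith [mul_nonneg (mul_nonneg hκ0.le hκ0.le) hx0]
    linarith [mul_le_mul_of_nonneg_right (e1.trans e2) hQ0]
  have f2 : (z - β) ⬝ᵥ (z - β) / η ≤ κ * Q + κ * x * Q := by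
    have e1 : x * (1 + x / 2) ≤ M / γ * Q * (1 + x) := by
      calc x * (1 + x / 2) ≤ (x - x ^ 2 / 4) * (1 + x) := by
            have : 0 ≤ x ^ 2 * (1 - x) := mul_nonneg (sq_nonneg _) (by linarith)
            linarith
        _ ≤ _ := by gcongr
    rw [div_le_iff₀ hη]
    calc _ ≤ κ ^ 2 * (x * (1 + x / 2)) := by linarith
      _ ≤ κ ^ 2 * (M / γ * Q * (1 + x)) := by gcongr
      _ = κ * (κ * (M / γ)) * Q * (1 + x) := by ring
      _ = κ * η * Q * (1 + x) := by
        have : κ * (M / γ) = η := by rw [hκ]; field_simp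
        rw [this]
      _ = _ := by ring
  rw [hd2] at hdesc
  linarith

/-- One step of the algorithm contracts the Lyapunov function, up to a noise term. -/
theorem exists_excess_step {M γ c₀ η c₁ K k : ℝ}
    (hM : 1 ≤ M) (hγ : 0 < γ) (hγ1 : γ ≤ 1) (hc₀ : 0 < c₀) (hc₀' : c₀ < 1) (hη : 0 < η)
    (hηM : 8 * M * η ≤ 1) (hc₁ : 0 < c₁) (hK : 0 < K) (hk : 0 < k) :
    ∃ q₀ > (0 : ℝ), ∃ r₀ > (0 : ℝ), ∃ A > (0 : ℝ),
    ∀ (p : ℕ) (ρ r b L' : ℝ) (S Lam Sh Lh : Matrix (Fin p) (Fin p) ℝ) (ξ β β' : Fin p → ℝ),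
    IsLeadingPair M γ ρ S Lam ξ → 1 ≤ l0norm ξ →
    (∀ u v, |u ⬝ᵥ Sh *ᵥ v - u ⬝ᵥ S *ᵥ v|
      ≤ ρ * (K * r * mixedNorm (l0norm ξ) u * mixedNorm (l0norm ξ) v)) →
    (∀ u v, |u ⬝ᵥ Lh *ᵥ v - u ⬝ᵥ Lam *ᵥ v|
      ≤ K * r * mixedNorm (l0norm ξ) u * mixedNorm (l0norm ξ) v) →
    0 ≤ r → r ≤ r₀ → k * r ≤ b →
    IsUnitVec β → l1norm β ≤ l1norm ξ + b * √(l0norm ξ : ℝ) →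
    l1norm ξ + b * √(l0norm ξ : ℝ) ≤ (1 + c₁) * √(l0norm ξ : ℝ) →
    L' ≤ l1norm ξ + b * √(l0norm ξ : ℝ) →
    l1norm ξ + (1 - η * γ / M / 4) * b * √(l0norm ξ : ℝ) ≤ L' →
    excess ρ S Lam β ≤ q₀ → excess ρ S Lam β ≤ q₀ * b →
    β' ∈ feasible p L' →
    IsMinOn (fun b => (b - proxTarget Sh Lh η β) ⬝ᵥ (b - proxTarget Sh Lh η β))
      (feasible p L') β' →
    excess ρ S Lam β' ≤ (1 - η * ((1 - c₀) * γ ^ 2 / M)) * excess ρ S Lam β + A * r * b := by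
  have hM0 : 0 < M := by linarith
  obtain ⟨κ, hκ⟩ : ∃ κ, κ = η * γ / M := ⟨_, rfl⟩
  obtain ⟨g, hg⟩ : ∃ g, g = 2 * M / γ := ⟨_, rfl⟩
  obtain ⟨C₁, hC₁⟩ : ∃ C₁, C₁ = 54 * K * (2 + c₁) + 8 * M ^ 2 * K * (2 + c₁) ^ 2 := ⟨_, rfl⟩
  obtain ⟨C₂, hC₂⟩ : ∃ C₂, C₂ = 4 * M ^ 2 := ⟨_, rfl⟩
  have hκ0 : 0 < κ := by rw [hκ]; positivity
  have hg0 : 0 < g := by rw [hg]; positivity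
  have hC₁0 : 0 < C₁ := by rw [hC₁]; positivity
  have hC₂0 : 0 < C₂ := by rw [hC₂]; positivity
  obtain ⟨q₀, hq₀, hq₁, hq₂, hq₃, hq₄, hq₅, hq₆⟩ : ∃ q₀ : ℝ, 0 < q₀ ∧
      q₀ ≤ (c₀ * κ / (4 * C₂)) ^ 2 / g ∧ q₀ ≤ c₀ / 4 / (5 * g) ∧ q₀ ≤ c₀ * κ / 4 / C₂ ^ 2 ∧
      q₀ ≤ 1 / (4 * M) ∧ q₀ ≤ 1 / g ∧ q₀ ≤ 3 / 4 / (g * (1 + c₁)) := by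
    refine ⟨min ((c₀ * κ / (4 * C₂)) ^ 2 / g) (min (c₀ / 4 / (5 * g)) (min (c₀ * κ / 4 / C₂ ^ 2)
      (min (1 / (4 * M)) (min (1 / g) (3 / 4 / (g * (1 + c₁))))))), ?_, ?_⟩
    · simp only [lt_min_iff]
      refine ⟨?_, ?_, ?_, ?_, ?_, ?_⟩ <;> positivity
    · rw [← le_min_iff, ← le_min_iff, ← le_min_iff, ← le_min_iff, ← le_min_iff]
  rw [le_div_iff₀ (by positivity)] at hq₁ hq₂ hq₃ hq₅ hq₆
  refine ⟨q₀, hq₀, 1 / (4 * M) / (2 * K * (2 + c₁) ^ 2), by positivity,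
    C₁ ^ 2 * (1 + g / (c₀ * κ)) / k + C₁, by positivity, ?_⟩
  intro p ρ r b L' S Lam Sh Lh ξ β β' h hs hS hL hr hr' hkr hβ hβ1 hb hL' hL'' hQ hQb hβ' hmin
  rw [le_div_iff₀ (by positivity)] at hr'
  rw [← hκ] at hL''
  have key : excess ρ S Lam β' ≤ (1 - (1 - c₀) * κ) * excess ρ S Lam β
      + (C₁ ^ 2 * (1 + g / (c₀ * κ)) / k + C₁) * r * b := by
    rcases le_total 0 (β ⬝ᵥ ξ) with hsign | hsign
    · exact excess_step_of_nonneg hM hγ hγ1 hc₀ hη hηM hc₁ hK hk hκ hg hC₁ hC₂ (by linarith)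
        (by linarith) (by linarith) hq₄ (by linarith) (by linarith) (by linarith) h hs hS hL hr hkr
        hβ hβ1 hb hL' hL'' hQ hQb hβ' hmin hsign
    · have hsign' : 0 ≤ β ⬝ᵥ (-ξ) := by rw [dotProduct_neg]; linarith
      rw [← l0norm_neg ξ] at hs hS hL hβ1 hb hL' hL''
      rw [← l1norm_neg ξ] at hβ1 hb hL' hL''
      exact excess_step_of_nonneg hM hγ hγ1 hc₀ hη hηM hc₁ hK hk hκ hg hC₁ hC₂ (by linarith)
        (by linarith) (by linarith) hq₄ (by linarith) (by linarith) (by linarith) h.neg hs hS hL hr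
        hkr hβ hβ1 hb hL' hL'' hQ hQb hβ' hmin hsign'
  -- The rate (1 − c₀)κ obtained is weakened to ην = (1 − c₀)κγ, using γ ≤ 1.
  refine key.trans ?_
  gcongr ?_ * _ + _
  · exact h.excess_nonneg β
  · have : η * ((1 - c₀) * γ ^ 2 / M) = (1 - c₀) * κ * γ := by rw [hκ]; ring
    rw [this]
    have : 0 ≤ (1 - c₀) * κ := mul_nonneg (by linarith) hκ0.le
    nlinarith

/-! ### Iterating the one-step bound. -/

/-- A linear recursion with a slowly decaying forcing term. -/
theorem recursion_bound {ω A r q₀ a c : ℝ} {q b : ℕ → ℝ} {T : ℕ} (hω : 0 < ω) (hω1 : ω ≤ 1)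
    (hA : 0 < A) (hr : 0 ≤ r) (hb0 : a ≤ b 0) (hbc : ∀ t, b t ≤ c) (hq₀ : 0 < q₀)
    (hbpos : ∀ t ≤ T, 0 ≤ b t) (hbdec : ∀ t < T, (1 - ω / 4) * b t ≤ b (t + 1))
    (hstart : q 0 ≤ q₀ / 2) (hstart' : q 0 ≤ q₀ / 2 * a)
    (hr₁ : 2 * A / ω * r * c ≤ q₀ / 2) (hr₂ : 2 * A / ω * r ≤ q₀ / 2)
    (hstep : ∀ t < T, q t ≤ q₀ → q t ≤ q₀ * b t → q (t + 1) ≤ (1 - ω) * q t + A * r * b t) :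
    ∀ t ≤ T, q t ≤ (1 - ω) ^ t * q 0 + 2 * A / ω * r * b t := by
  -- The forcing decays more slowly than the contraction; hence the condition q ≤ q₀b, once true,
  -- persists.
  have hbl : ∀ t ≤ T, (1 - ω) ^ t * a ≤ b t := by
    intro t
    induction t with
    | zero => intro _; simpa using hb0
    | succ t ih =>
      intro ht
      have h1 := ih (by omega)
      have h2 := hbdec t (by omega)
      have h3 := hbpos t (by omega)
      rw [pow_succ]
      nlinarith
  have hAr : 0 ≤ 2 * A / ω * r := by positivity
  intro t
  induction t with
  | zero =>
    intro h0
    have := mul_nonneg hAr (hbpos 0 h0)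
    simpa using this
  | succ t ih =>
    intro ht
    have hih := ih (by omega)
    have hbt := hbpos t (by omega)
    have hpow : (1 - ω) ^ t ≤ 1 := pow_le_one₀ (by linarith) (by linarith)
    have hpow0 : 0 ≤ (1 - ω) ^ t := pow_nonneg (by linarith) t
    have e1 : q t ≤ q₀ := by
      have h1 : (1 - ω) ^ t * q 0 ≤ q₀ / 2 := by nlinarith
      have h2 : 2 * A / ω * r * b t ≤ 2 * A / ω * r * c := mul_le_mul_of_nonneg_left (hbc t) hAr
      linarith
    have e2 : q t ≤ q₀ * b t := by
      have h1 : (1 - ω) ^ t * q 0 ≤ q₀ / 2 * b t := by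
        calc (1 - ω) ^ t * q 0 ≤ (1 - ω) ^ t * (q₀ / 2 * a) := by gcongr
          _ = q₀ / 2 * ((1 - ω) ^ t * a) := by ring
          _ ≤ q₀ / 2 * b t := by gcongr; exact hbl t (by omega)
      have h2 : 2 * A / ω * r * b t ≤ q₀ / 2 * b t := mul_le_mul_of_nonneg_right hr₂ hbt
      linarith
    have h3 := hstep t (by omega) e1 e2
    have h4 := mul_le_mul_of_nonneg_left hih (show 0 ≤ 1 - ω by linarith)
    have h5 := mul_le_mul_of_nonneg_left (hbdec t (by omega)) hAr
    -- Passing from b_t to b_{t+1} leaves room (3/2)A r b_t for the new noise A r b_t; the factor 2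
    -- in 2A/ω provides it.
    have h6 : 2 * A / ω * r * ((1 - ω / 4) * b t)
        = (1 - ω) * (2 * A / ω * r * b t) + 3 / 2 * (A * r * b t) := by field_simp; ring
    have h7 : 0 ≤ A * r * b t := by positivity
    rw [pow_succ]
    linarith

/-! ### Block-diagonal forms and the population eigenstructure. -/

/-- The restriction of a vector to the features of block `d`, extended by zero. -/
def mask {p D : ℕ} (blk : Fin p → Fin D) (d : Fin D) (u : Fin p → ℝ) : Fin p → ℝ :=
  fun i => if blk i = d then u i else 0

section Blocks
variable {p D : ℕ} (blk : Fin p → Fin D)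

/-- Reduces block-diagonal forms to ordinary quadratic forms at masked vectors, both for the
eigenvalue bounds and, with the empirical covariance, for sums of squares of Gaussian projections.
-/
theorem dotProduct_blockDiag (H : Matrix (Fin p) (Fin p) ℝ) (u v : Fin p → ℝ) :
    u ⬝ᵥ blockDiag blk H *ᵥ v = ∑ d, mask blk d u ⬝ᵥ H *ᵥ mask blk d v := by
  simp only [dotProduct, mulVec, blockDiag, mask, of_apply, Finset.mul_sum]
  conv_rhs => rw [Finset.sum_comm]
  refine Finset.sum_congr rfl fun i _ => ?_
  conv_rhs => rw [Finset.sum_comm]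
  refine Finset.sum_congr rfl fun j _ => ?_
  rw [Finset.sum_eq_single (blk i)]
  · simp only [if_true, eq_comm (a := blk i)]
    split_ifs <;> simp
  · intro d _ hd
    simp [hd.symm]
  · simp

theorem dotProduct_mask_self (u : Fin p → ℝ) : ∑ d, mask blk d u ⬝ᵥ mask blk d u = u ⬝ᵥ u := by
  simp only [dotProduct, mask]
  rw [Finset.sum_comm]
  refine Finset.sum_congr rfl fun i _ => ?_
  rw [Finset.sum_eq_single (blk i)] <;> simp +contextual [eq_comm]

theorem sum_mask (d : Fin D) (f : Fin p → ℝ) :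
    ∑ i, (if blk i = d then f i else 0) = ∑ i : {i // blk i = d}, f i := by
  rw [← Finset.sum_filter]
  exact Finset.sum_subtype _ (by simp) f

theorem dotProduct_mask_mulVec (H : Matrix (Fin p) (Fin p) ℝ) (d : Fin D) (u : Fin p → ℝ) :
    mask blk d u ⬝ᵥ H *ᵥ mask blk d u
      = (fun i : {i // blk i = d} => u i) ⬝ᵥ block blk H d *ᵥ (fun i => u i) := by
  simp only [dotProduct, mulVec, block, submatrix_apply, mask, ite_mul, zero_mul, mul_ite, mul_zero]
  rw [sum_mask blk d fun i => u i * ∑ j, if blk j = d then H i j * u j else 0]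
  refine Finset.sum_congr rfl fun i _ => ?_
  rw [sum_mask blk d fun j => H i j * u j]

theorem dotProduct_mask_mask (d : Fin D) (u : Fin p → ℝ) :
    mask blk d u ⬝ᵥ mask blk d u
      = (fun i : {i // blk i = d} => u i) ⬝ᵥ (fun i : {i // blk i = d} => u i) := by
  simp only [dotProduct, mask, ite_mul, zero_mul, mul_ite, mul_zero]
  rw [← sum_mask blk d fun i => u i * u i]
  exact Finset.sum_congr rfl fun i _ => by split_ifs <;> rfl

end Blocks

section Spectrum
open scoped MatrixOrder

theorem quad_bounds_of_spectrum {ι : Type*} [Fintype ι] [DecidableEq ι] {A : Matrix ι ι ℝ}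
    (hA : A.IsHermitian) {a b : ℝ} (h : spectrum ℝ A ⊆ Set.Icc a b) (v : ι → ℝ) :
    a * (v ⬝ᵥ v) ≤ v ⬝ᵥ A *ᵥ v ∧ v ⬝ᵥ A *ᵥ v ≤ b * (v ⬝ᵥ v) := by
  have hA' : IsSelfAdjoint A := hA
  have h1 : algebraMap ℝ (Matrix ι ι ℝ) a ≤ A :=
    (algebraMap_le_iff_le_spectrum).2 fun x hx => (h hx).1
  have h2 : A ≤ algebraMap ℝ (Matrix ι ι ℝ) b :=
    (le_algebraMap_iff_spectrum_le).2 fun x hx => (h hx).2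
  rw [Matrix.le_iff] at h1 h2
  have h1 := h1.dotProduct_mulVec_nonneg v
  have h2 := h2.dotProduct_mulVec_nonneg v
  simp only [Algebra.algebraMap_eq_smul_one, sub_mulVec, smul_mulVec, one_mulVec, dotProduct_sub,
    dotProduct_smul, star_trivial, smul_eq_mul] at h1 h2
  exact ⟨by linarith, by linarith⟩

end Spectrum

section Population
variable {p D : ℕ}

theorem blockDiag_quad_bounds (blk : Fin p → Fin D) {S : Matrix (Fin p) (Fin p) ℝ}
    (hS : S.PosSemidef) {a b : ℝ} (h : ∀ d, spectrum ℝ (block blk S d) ⊆ Set.Icc a b)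
    (u : Fin p → ℝ) :
    a * (u ⬝ᵥ u) ≤ u ⬝ᵥ blockDiag blk S *ᵥ u ∧ u ⬝ᵥ blockDiag blk S *ᵥ u ≤ b * (u ⬝ᵥ u) := by
  have hd : ∀ d, a * (mask blk d u ⬝ᵥ mask blk d u) ≤ mask blk d u ⬝ᵥ S *ᵥ mask blk d u ∧
      mask blk d u ⬝ᵥ S *ᵥ mask blk d u ≤ b * (mask blk d u ⬝ᵥ mask blk d u) := fun d => by
    rw [dotProduct_mask_mulVec, dotProduct_mask_mask]
    exact quad_bounds_of_spectrum (hS.submatrix _).isHermitian (h d) _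
  rw [dotProduct_blockDiag, ← dotProduct_mask_self blk u, Finset.mul_sum, Finset.mul_sum]
  exact ⟨Finset.sum_le_sum fun d _ => (hd d).1, Finset.sum_le_sum fun d _ => (hd d).2⟩

theorem bilin_comm_of_isHermitian {A : Matrix (Fin p) (Fin p) ℝ} (hA : A.IsHermitian)
    (u v : Fin p → ℝ) : u ⬝ᵥ A *ᵥ v = v ⬝ᵥ A *ᵥ u := by
  have : Aᵀ = A := by rw [← conjTranspose_eq_transpose_of_trivial]; exact hA
  rw [dotProduct_mulVec, ← mulVec_transpose, this, dotProduct_comm]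

theorem blockDiag_isHermitian (blk : Fin p → Fin D) {S : Matrix (Fin p) (Fin p) ℝ}
    (hS : S.IsHermitian) : (blockDiag blk S).IsHermitian := by
  ext i j
  have := hS.apply i j
  simp only [star_trivial] at this
  simp [blockDiag, this, eq_comm]

/-- A bound on the Rayleigh quotient over the unit vectors of a cone extends to the cone. -/
theorem quad_le_of_isMaxOn {S Lam : Matrix (Fin p) (Fin p) ℝ} {F : Set (Fin p → ℝ)}
    {ξ w : Fin p → ℝ} (hmax : IsMaxOn (rayleigh S Lam) F ξ)
    (hF : w ≠ 0 → (l2norm w)⁻¹ • w ∈ F) (hpos : w ≠ 0 → 0 < w ⬝ᵥ Lam *ᵥ w) :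
    w ⬝ᵥ S *ᵥ w ≤ rayleigh S Lam ξ * (w ⬝ᵥ Lam *ᵥ w) := by
  by_cases hw : w = 0
  · simp [hw]
  · have h1 : rayleigh S Lam ((l2norm w)⁻¹ • w) ≤ rayleigh S Lam ξ := hmax (hF hw)
    have hpw := hpos hw
    have hn := l2norm_ne_zero hw
    have h2 : rayleigh S Lam ((l2norm w)⁻¹ • w) = (w ⬝ᵥ S *ᵥ w) / (w ⬝ᵥ Lam *ᵥ w) := by
      unfold rayleigh
      simp only [mulVec_smul, dotProduct_smul, smul_dotProduct, smul_eq_mul]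
      field_simp
    rw [h2, div_le_iff₀ hpw] at h1
    exact h1

theorem isUnitVec_normalize {w : Fin p → ℝ} (hw : w ≠ 0) : IsUnitVec ((l2norm w)⁻¹ • w) := by
  have hn := l2norm_ne_zero hw
  unfold IsUnitVec
  rw [smul_dotProduct, dotProduct_smul, ← l2norm_sq]
  simp only [smul_eq_mul]
  field_simp

/-- The form ρΛ − S is semidefinite by maximality and vanishes at ξ₁, so Cauchy–Schwarz gives Sξ₁ =
ρΛξ₁. For the gap, remove from u its Λ-projection on ξ₁: the excess is unchanged, the remainder
obeys the bound by ρ₂, and its squared norm is at least that of the Euclidean residual, 1 − (uᵀξ₁)².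
-/
theorem isLeadingPair_of_directions {M γ : ℝ} (hM : 0 < M) (hp : 2 ≤ p) (blk : Fin p → Fin D)
    {S : Matrix (Fin p) (Fin p) ℝ} (hS : S.PosSemidef)
    (hspec : ∀ d, spectrum ℝ (block blk S d) ⊆ Set.Icc (1 / M) M) {ξ : ℕ → Fin p → ℝ}
    (hξ : IsMCCADirections S (blockDiag blk S) ξ)
    (hρ : 0 < rayleigh S (blockDiag blk S) (ξ 1))
    (hgap : γ * rayleigh S (blockDiag blk S) (ξ 1)
      ≤ rayleigh S (blockDiag blk S) (ξ 1) - rayleigh S (blockDiag blk S) (ξ 2)) (hγ : 0 < γ) :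
    IsLeadingPair M γ (rayleigh S (blockDiag blk S) (ξ 1)) S (blockDiag blk S) (ξ 1) := by
  set Lam := blockDiag blk S with hLam
  set ρ := rayleigh S Lam (ξ 1) with hρdef
  have hq := blockDiag_quad_bounds blk hS hspec
  have hsS := bilin_comm_of_isHermitian hS.isHermitian
  have hsL := bilin_comm_of_isHermitian (blockDiag_isHermitian blk hS.isHermitian)
  rw [← hLam] at hq hsL
  have hlow : ∀ u, u ⬝ᵥ u ≤ M * (u ⬝ᵥ Lam *ᵥ u) := fun u => by
    have := (hq u).1
    rw [div_mul_eq_mul_div, div_le_iff₀ hM] at this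
    linarith
  have hpos : ∀ w : Fin p → ℝ, w ≠ 0 → 0 < w ⬝ᵥ Lam *ᵥ w := fun w hw => by
    have h1 := hlow w
    have h2 : 0 < w ⬝ᵥ w :=
      lt_of_le_of_ne (dotProduct_self_nonneg' w) fun h => hw (dotProduct_self_eq_zero.1 h.symm)
    exact pos_of_mul_pos_right (h2.trans_le h1) hM.le
  have hnonneg : ∀ u, 0 ≤ u ⬝ᵥ S *ᵥ u := fun u => by
    simpa using hS.dotProduct_mulVec_nonneg u
  obtain ⟨⟨hu1, -⟩, hmax1⟩ := hξ 1 (by simp; omega)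
  obtain ⟨-, hmax2⟩ := hξ 2 (by simp; omega)
  have hle : ∀ u, u ⬝ᵥ S *ᵥ u ≤ ρ * (u ⬝ᵥ Lam *ᵥ u) := fun u =>
    quad_le_of_isMaxOn hmax1 (fun hu => ⟨isUnitVec_normalize hu, by simp⟩) (hpos u)
  have hξ0 : ξ 1 ≠ 0 := by
    rintro h0
    simp [IsUnitVec, h0] at hu1
  have hξpos := hpos _ hξ0
  have hξξ : ξ 1 ⬝ᵥ S *ᵥ ξ 1 = ρ * (ξ 1 ⬝ᵥ Lam *ᵥ ξ 1) := by
    rw [hρdef, rayleigh]; field_simp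
  have hAq : ∀ u v, u ⬝ᵥ (ρ • Lam - S) *ᵥ v = ρ * (u ⬝ᵥ Lam *ᵥ v) - u ⬝ᵥ S *ᵥ v := fun u v => by
    simp [sub_mulVec, smul_mulVec, dotProduct_sub, dotProduct_smul]
  have heig : ∀ u, u ⬝ᵥ S *ᵥ ξ 1 = ρ * (u ⬝ᵥ Lam *ᵥ ξ 1) := fun u => by
    have h := sq_bilin_le (A := ρ • Lam - S) (fun u v => by rw [hAq, hAq, hsS u v, hsL u v])
      (fun u => by rw [hAq]; linarith [hle u]) u (ξ 1)
    rw [hAq u (ξ 1), hAq (ξ 1), hξξ, sub_self, mul_zero] at h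
    have := pow_eq_zero_iff (two_ne_zero) |>.1 (le_antisymm h (sq_nonneg _))
    linarith
  refine ⟨hρ, hu1, hsS, hsL, hnonneg, hlow, fun u => (hq u).2, hle, heig, fun u hu => ?_⟩
  set a := (u ⬝ᵥ Lam *ᵥ ξ 1) / (ξ 1 ⬝ᵥ Lam *ᵥ ξ 1) with ha
  have haξ : a * (ξ 1 ⬝ᵥ Lam *ᵥ ξ 1) = u ⬝ᵥ Lam *ᵥ ξ 1 := by rw [ha]; field_simp
  have horth : (u + (-a) • ξ 1) ⬝ᵥ Lam *ᵥ ξ 1 = 0 := by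
    rw [add_dotProduct, smul_dotProduct, smul_eq_mul, neg_mul, haξ]; ring
  have hw2 : (u + (-a) • ξ 1) ⬝ᵥ S *ᵥ (u + (-a) • ξ 1)
      ≤ rayleigh S Lam (ξ 2) * ((u + (-a) • ξ 1) ⬝ᵥ Lam *ᵥ (u + (-a) • ξ 1)) := by
    refine quad_le_of_isMaxOn hmax2 (fun hw => ⟨isUnitVec_normalize hw, ?_⟩) (hpos _)
    intro j' hj'
    obtain rfl : j' = 1 := by simp at hj'; omega
    rw [smul_dotProduct, horth, smul_zero]
  set w := u + (-a) • ξ 1 with hw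
  have hwL : 0 ≤ w ⬝ᵥ Lam *ᵥ w := nonneg_of_mul_nonneg_right
    ((dotProduct_self_nonneg' w).trans (hlow w)) hM
  have hw3 : w ⬝ᵥ S *ᵥ w / ρ ≤ (1 - γ) * (w ⬝ᵥ Lam *ᵥ w) := by
    rw [div_le_iff₀ hρ]
    refine hw2.trans ?_
    have : rayleigh S Lam (ξ 2) ≤ (1 - γ) * ρ := by linarith
    calc _ ≤ (1 - γ) * ρ * (w ⬝ᵥ Lam *ᵥ w) := by gcongr
      _ = _ := by ring
  have hww : 1 - (u ⬝ᵥ ξ 1) ^ 2 ≤ w ⬝ᵥ w := by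
    unfold IsUnitVec at hu hu1
    rw [hw]
    simp only [add_dotProduct, dotProduct_add, smul_dotProduct, dotProduct_smul, smul_eq_mul, hu,
      hu1, dotProduct_comm (ξ 1) u]
    nlinarith [sq_nonneg (a - u ⬝ᵥ ξ 1)]
  have hex : w ⬝ᵥ Lam *ᵥ w - w ⬝ᵥ S *ᵥ w / ρ = u ⬝ᵥ Lam *ᵥ u - u ⬝ᵥ S *ᵥ u / ρ := by
    rw [hw, quad_add hsS, quad_add hsL]
    simp only [mulVec_smul, dotProduct_smul, smul_dotProduct, smul_eq_mul, heig]
    field_simp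
    ring
  rw [← hex]
  have h1 : γ * (w ⬝ᵥ Lam *ᵥ w) ≤ w ⬝ᵥ Lam *ᵥ w - w ⬝ᵥ S *ᵥ w / ρ := by linarith
  calc γ * (1 - (u ⬝ᵥ ξ 1) ^ 2) ≤ γ * (M * (w ⬝ᵥ Lam *ᵥ w)) := by
        gcongr; exact hww.trans (hlow w)
    _ = M * (γ * (w ⬝ᵥ Lam *ᵥ w)) := by ring
    _ ≤ _ := by gcongr

end Population
-- Discretization by sparse integer vectors.
section Net
variable {p : ℕ}

/-- The signed coordinate vectors and zero. -/
def signedUnits (p : ℕ) : Finset (Fin p → ℤ) :=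
  insert 0 (Finset.univ.image (fun i => Pi.single i 1) ∪ Finset.univ.image (fun i => Pi.single i (-1)))

/-- The sums of `m` signed coordinate vectors. -/
def intNet (p : ℕ) : ℕ → Finset (Fin p → ℤ)
  | 0 => {0}
  | m + 1 => Finset.image₂ (· + ·) (intNet p m) (signedUnits p)

theorem card_signedUnits_le (p : ℕ) : (signedUnits p).card ≤ 2 * p + 1 := by
  refine (Finset.card_insert_le _ _).trans ?_
  have h := Finset.card_union_le (Finset.univ.image (fun i : Fin p => (Pi.single i 1 : Fin p → ℤ)))
    (Finset.univ.image (fun i : Fin p => (Pi.single i (-1) : Fin p → ℤ)))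
  have h1 := Finset.card_image_le (s := Finset.univ) (f := fun i : Fin p => (Pi.single i 1 : Fin p → ℤ))
  have h2 := Finset.card_image_le (s := Finset.univ)
    (f := fun i : Fin p => (Pi.single i (-1) : Fin p → ℤ))
  simp only [Finset.card_univ, Fintype.card_fin] at h1 h2
  omega

theorem card_intNet_le (p m : ℕ) : (intNet p m).card ≤ (2 * p + 1) ^ m := by
  induction m with
  | zero => simp [intNet]
  | succ m ih =>
    rw [intNet, pow_succ]
    exact (Finset.card_image₂_le _ _ _).trans (Nat.mul_le_mul ih (card_signedUnits_le p))

/-- Induction on `m`: moving one non-zero coordinate a unit towards zero lowers the ℓ₁ norm by one.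
The zero summand in `signedUnits` covers vectors of smaller norm. -/
theorem mem_intNet_of_sum_abs_le {m : ℕ} {k : Fin p → ℤ} (h : ∑ i, |k i| ≤ m) : k ∈ intNet p m := by
  induction m generalizing k with
  | zero =>
    have : ∀ i, k i = 0 := fun i => by
      have h1 := Finset.single_le_sum (f := fun i => |k i|) (fun i _ => abs_nonneg _)
        (Finset.mem_univ i)
      have h2 := abs_nonneg (k i)
      push_cast at h
      exact abs_eq_zero.1 (le_antisymm (h1.trans h) h2)
    simp [intNet, funext_iff, this]
  | succ m ih =>
    rw [intNet]
    by_cases hk : k = 0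
    · refine Finset.mem_image₂.2 ⟨0, ih (by simp), 0, by simp [signedUnits], by simp [hk]⟩
    · obtain ⟨i, hi⟩ : ∃ i, k i ≠ 0 := Function.ne_iff.1 hk
      have hdec : ∀ e : ℤ, |k i - e| = |k i| - 1 → ∑ j, |(k - (Pi.single i e : Fin p → ℤ)) j| ≤ (m : ℤ) := by
        intro e he
        rw [← Finset.add_sum_erase _ _ (Finset.mem_univ i)] at h ⊢
        have hrest : ∑ j ∈ Finset.univ.erase i, |(k - (Pi.single i e : Fin p → ℤ)) j|
            = ∑ j ∈ Finset.univ.erase i, |k j| := by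
          refine Finset.sum_congr rfl fun j hj => ?_
          simp [Finset.ne_of_mem_erase hj]
        rw [hrest]
        simp only [Pi.sub_apply, Pi.single_eq_same, he]
        push_cast at h
        linarith
      rcases lt_or_gt_of_ne hi with hneg | hpos
      · refine Finset.mem_image₂.2 ⟨k - Pi.single i (-1), ih (hdec _ ?_), Pi.single i (-1),
          by simp [signedUnits], by simp⟩
        rw [abs_of_neg hneg, abs_of_nonpos (by omega)]; ring
      · refine Finset.mem_image₂.2 ⟨k - Pi.single i 1, ih (hdec _ ?_), Pi.single i 1,
          by simp [signedUnits], by simp⟩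
        rw [abs_of_pos hpos, abs_of_nonneg (by omega)]

/-- Integers satisfy |k| ≤ k², so a Euclidean bound already forces sparsity; this is the advantage
of an integer net. -/
theorem mem_intNet_of_sum_sq_le {m : ℕ} {k : Fin p → ℤ} (h : ∑ i, k i ^ 2 ≤ m) :
    k ∈ intNet p m := by
  refine mem_intNet_of_sum_abs_le (le_trans (Finset.sum_le_sum fun i _ => ?_) h)
  rw [← sq_abs]
  rcases (abs_nonneg (k i)).eq_or_lt with h0 | h0
  · rw [← h0]; norm_num
  · nlinarith

/-- The largest `s` values of a non-negative function dominate every average with weights in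
`[0, 1]` of total mass at most `s`. -/
theorem exists_dominating_finset {ι : Type*} [Fintype ι] [DecidableEq ι] {s : ℕ} (hs : 1 ≤ s)
    (f : ι → ℝ) (hf : ∀ i, 0 ≤ f i) : ∃ A : Finset ι, A.card ≤ s ∧ ∀ r : ι → ℝ,
      (∀ i, 0 ≤ r i) → (∀ i, r i ≤ 1) → ∑ i, r i ≤ s → ∑ i, r i * f i ≤ ∑ i ∈ A, f i := by
  rcases le_or_gt (Fintype.card ι) s with hc | hc
  · refine ⟨Finset.univ, by simpa using hc, fun r _ h1 _ => Finset.sum_le_sum fun i _ => ?_⟩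
    exact mul_le_of_le_one_left (hf i) (h1 i)
  · obtain ⟨A, hA, hmax⟩ := Finset.exists_max_image (Finset.univ.powersetCard s)
      (fun A => ∑ i ∈ A, f i) (Finset.powersetCard_nonempty.2 (by simpa using hc.le))
    have hAc : A.card = s := (Finset.mem_powersetCard.1 hA).2
    obtain ⟨i₀, hi₀, hmin⟩ := Finset.exists_min_image A f (Finset.card_pos.1 (by omega))
    have hout : ∀ j ∉ A, f j ≤ f i₀ := fun j hj => by
      have hj' : j ∉ A.erase i₀ := fun h => hj (Finset.mem_of_mem_erase h)
      have := hmax (insert j (A.erase i₀)) (by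
        rw [Finset.mem_powersetCard]
        refine ⟨Finset.subset_univ _, ?_⟩
        rw [Finset.card_insert_of_notMem hj', Finset.card_erase_of_mem hi₀]
        omega)
      rw [Finset.sum_insert hj', ← Finset.add_sum_erase A f hi₀] at this
      linarith
    refine ⟨A, hAc.le, fun r h0 h1 hsum => ?_⟩
    -- Fractional knapsack: relative to the threshold `f i₀`, values are non-negative on `A` and
    -- non-positive outside it.
    have e1 : ∑ i, r i * (f i - f i₀) ≤ ∑ i ∈ A, (f i - f i₀) := by
      rw [← Finset.sum_filter_add_sum_filter_not Finset.univ (fun i => i ∈ A)]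
      have hfil : Finset.univ.filter (fun i => i ∈ A) = A := by ext; simp
      rw [hfil]
      have g1 : ∑ i ∈ A, r i * (f i - f i₀) ≤ ∑ i ∈ A, (f i - f i₀) :=
        Finset.sum_le_sum fun i hi =>
          mul_le_of_le_one_left (sub_nonneg.2 (hmin i hi)) (h1 i)
      have g2 : ∑ i ∈ Finset.univ.filter (fun i => ¬ i ∈ A), r i * (f i - f i₀) ≤ 0 :=
        Finset.sum_nonpos fun i hi =>
          mul_nonpos_of_nonneg_of_nonpos (h0 i) (sub_nonpos.2 (hout i (by simpa using hi)))
      linarith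
    have e2 : ∑ i, r i * (f i - f i₀) = ∑ i, r i * f i - (∑ i, r i) * f i₀ := by
      simp only [mul_sub, Finset.sum_sub_distrib, Finset.sum_mul]
    have e3 : ∑ i ∈ A, (f i - f i₀) = ∑ i ∈ A, f i - s * f i₀ := by
      rw [Finset.sum_sub_distrib, Finset.sum_const, hAc, nsmul_eq_mul]
    have e4 : (∑ i, r i) * f i₀ ≤ s * f i₀ := mul_le_mul_of_nonneg_right hsum (hf i₀)
    linarith

/-- Rounding of a real number towards zero. -/
theorem exists_int_trunc (x : ℝ) : ∃ k : ℤ, |(k : ℝ)| ≤ |x| ∧ |x - k| ≤ 1 ∧ |x - k| ≤ |x| := by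
  rcases le_total 0 x with h | h
  · refine ⟨⌊x⌋, ?_, ?_, ?_⟩
    all_goals
      have h0 : (0 : ℝ) ≤ ⌊x⌋ := by exact_mod_cast Int.floor_nonneg.2 h
      have h1 := Int.floor_le x
      have h2 := Int.lt_floor_add_one x
      have h3 : 0 ≤ x - ⌊x⌋ := by linarith
      simp only [abs_of_nonneg h, abs_of_nonneg h0, abs_of_nonneg h3]
      linarith
  · refine ⟨⌈x⌉, ?_, ?_, ?_⟩
    all_goals
      have h0 : (⌈x⌉ : ℝ) ≤ 0 := by exact_mod_cast Int.ceil_le.2 (by simpa using h)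
      have h1 := Int.le_ceil x
      have h2 := Int.ceil_lt_add_one x
      have h3 : x - ⌈x⌉ ≤ 0 := by linarith
      simp only [abs_of_nonpos h, abs_of_nonpos h0, abs_of_nonpos h3]
      linarith

/-- A linear functional on the unit ball of the mixed norm is bounded by its values on scaled
sparse integer vectors. -/
theorem exists_int_rounding {s : ℕ} (hs : 1 ≤ s) (u w : Fin p → ℝ) (hu : u ⬝ᵥ u ≤ 1)
    (hu1 : l1norm u ≤ √(s : ℝ)) :
    ∃ k₁ k₂ : Fin p → ℤ, ∑ i, k₁ i ^ 2 ≤ (s : ℤ) ∧ ∑ i, k₂ i ^ 2 ≤ (s : ℤ) ∧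
      √(s : ℝ) * (w ⬝ᵥ u) ≤ w ⬝ᵥ (fun i => (k₁ i : ℝ)) + w ⬝ᵥ (fun i => (k₂ i : ℝ)) := by
  have hσ : √(s : ℝ) ^ 2 = s := Real.sq_sqrt (Nat.cast_nonneg _)
  have hσ0 := Real.sqrt_nonneg (s : ℝ)
  choose k hk1 hk2 hk3 using fun i => exists_int_trunc (√(s : ℝ) * u i)
  obtain ⟨A, hAc, hA⟩ := exists_dominating_finset hs (fun i => |w i|) (fun i => abs_nonneg _)
  -- `k` truncates √s·u. The rounding error has entries at most 1 in absolute value and total mass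
  -- at most s, so its pairing with `w` is dominated by the sign vector of `w` on the `s` largest
  -- entries.
  refine ⟨k, fun i => if i ∈ A then (if 0 ≤ w i then 1 else -1) else 0, ?_, ?_, ?_⟩
  · have : ∑ i, (k i : ℝ) ^ 2 ≤ s := by
      calc ∑ i, (k i : ℝ) ^ 2 ≤ ∑ i, (√(s : ℝ) * u i) ^ 2 :=
            Finset.sum_le_sum fun i _ => sq_le_sq.2 (hk1 i)
        _ = s * (u ⬝ᵥ u) := by
            rw [dotProduct, Finset.mul_sum]
            exact Finset.sum_congr rfl fun i _ => by rw [mul_pow, hσ]; ring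
        _ ≤ s := mul_le_of_le_one_right (Nat.cast_nonneg _) hu
    exact_mod_cast this
  · have : ∀ i, (if i ∈ A then (if 0 ≤ w i then (1 : ℤ) else -1) else 0) ^ 2
        = if i ∈ A then 1 else 0 := fun i => by split_ifs <;> norm_num
    simp only [this, Finset.sum_ite_mem, Finset.univ_inter, Finset.sum_const, nsmul_eq_mul, mul_one]
    exact_mod_cast hAc
  · have h1 := hA (fun i => |√(s : ℝ) * u i - k i|) (fun i => abs_nonneg _) hk2 (by
      calc ∑ i, |√(s : ℝ) * u i - k i| ≤ ∑ i, |√(s : ℝ) * u i| :=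
            Finset.sum_le_sum fun i _ => hk3 i
        _ = √(s : ℝ) * l1norm u := by
            rw [l1norm, Finset.mul_sum]
            exact Finset.sum_congr rfl fun i _ => by rw [abs_mul, abs_of_nonneg hσ0]
        _ ≤ √(s : ℝ) * √(s : ℝ) := by gcongr
        _ = s := by rw [← pow_two, hσ])
    have h2 : √(s : ℝ) * (w ⬝ᵥ u) - w ⬝ᵥ (fun i => (k i : ℝ))
        ≤ ∑ i, |√(s : ℝ) * u i - k i| * |w i| := by
      simp only [dotProduct, Finset.mul_sum, ← Finset.sum_sub_distrib]
      refine Finset.sum_le_sum fun i _ => ?_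
      rw [← abs_mul]
      refine le_trans (le_of_eq ?_) (le_abs_self _)
      ring
    have h3 : w ⬝ᵥ (fun i => (((if i ∈ A then (if 0 ≤ w i then 1 else -1) else 0 : ℤ)) : ℝ))
        = ∑ i ∈ A, |w i| := by
      rw [dotProduct, ← Finset.univ_inter A, ← Finset.sum_ite_mem, Finset.univ_inter]
      refine Finset.sum_congr rfl fun i _ => ?_
      split_ifs with ha hw
      · simp [abs_of_nonneg hw]
      · simp [abs_of_neg (not_le.1 hw)]
      · simp
    rw [h3]
    linarith

/-- A quadratic form that is small on scaled sparse integer vectors is small in the mixed norm. -/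
theorem abs_bilin_le_of_intNet {s : ℕ} (hs : 1 ≤ s) {E : Matrix (Fin p) (Fin p) ℝ}
    (hE : ∀ u v, u ⬝ᵥ E *ᵥ v = v ⬝ᵥ E *ᵥ u) {ε : ℝ}
    (h : ∀ k : Fin p → ℤ, ∑ i, k i ^ 2 ≤ (4 * s : ℤ) →
      |(fun i => (k i : ℝ)) ⬝ᵥ E *ᵥ (fun i => (k i : ℝ))| ≤ s * ε) (u v : Fin p → ℝ) :
    |u ⬝ᵥ E *ᵥ v| ≤ 2 * ε * mixedNorm s u * mixedNorm s v := by
  have hs0 : (0 : ℝ) < s := by exact_mod_cast hs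
  have hσ : √(s : ℝ) ^ 2 = s := Real.sq_sqrt (Nat.cast_nonneg _)
  have hσ0 : 0 < √(s : ℝ) := Real.sqrt_pos.2 hs0
  -- Polarization: 4kᵀEl is the difference of the forms at k + l and k − l, whose squared norms are
  -- at most 4s.
  have hpol : ∀ k l : Fin p → ℤ, ∑ i, k i ^ 2 ≤ (s : ℤ) → ∑ i, l i ^ 2 ≤ (s : ℤ) →
      (fun i => (k i : ℝ)) ⬝ᵥ E *ᵥ (fun i => (l i : ℝ)) ≤ s * ε / 2 := by
    intro k l hk hl
    have ha := h (k + l) (by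
      calc ∑ i, (k + l) i ^ 2 ≤ ∑ i, (2 * k i ^ 2 + 2 * l i ^ 2) :=
            Finset.sum_le_sum fun i _ => by simp only [Pi.add_apply]; nlinarith [sq_nonneg (k i - l i)]
        _ ≤ 4 * s := by rw [Finset.sum_add_distrib, ← Finset.mul_sum, ← Finset.mul_sum]; linarith)
    have hb := h (k - l) (by
      calc ∑ i, (k - l) i ^ 2 ≤ ∑ i, (2 * k i ^ 2 + 2 * l i ^ 2) :=
            Finset.sum_le_sum fun i _ => by simp only [Pi.sub_apply]; nlinarith [sq_nonneg (k i + l i)]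
        _ ≤ 4 * s := by rw [Finset.sum_add_distrib, ← Finset.mul_sum, ← Finset.mul_sum]; linarith)
    have e1 : (fun i => (((k + l) i : ℤ) : ℝ)) = (fun i => (k i : ℝ)) + (fun i => (l i : ℝ)) := by
      ext i; simp
    have e2 : (fun i => (((k - l) i : ℤ) : ℝ)) = (fun i => (k i : ℝ)) + -(fun i => (l i : ℝ)) := by
      ext i; simp [sub_eq_add_neg]
    rw [e1, quad_add hE] at ha
    rw [e2, quad_add hE] at hb
    simp only [mulVec_neg, dotProduct_neg, neg_dotProduct, neg_neg] at hb
    have := (abs_le.1 ha).2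
    have := (abs_le.1 hb).1
    linarith
  have hunit : ∀ u v : Fin p → ℝ, u ⬝ᵥ u ≤ 1 → l1norm u ≤ √(s : ℝ) → v ⬝ᵥ v ≤ 1 →
      l1norm v ≤ √(s : ℝ) → u ⬝ᵥ E *ᵥ v ≤ 2 * ε := by
    intro u v hu hu1 hv hv1
    -- Each argument is rounded in turn, at the cost of a factor 2 and a scaling by √s each time.
    have hone : ∀ k : Fin p → ℤ, ∑ i, k i ^ 2 ≤ (s : ℤ) →
        √(s : ℝ) * (v ⬝ᵥ E *ᵥ (fun i => (k i : ℝ))) ≤ s * ε := by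
      intro k hk
      obtain ⟨l₁, l₂, hl₁, hl₂, hl⟩ := exists_int_rounding hs v (E *ᵥ (fun i => (k i : ℝ))) hv hv1
      rw [dotProduct_comm, dotProduct_comm _ (fun i => (l₁ i : ℝ)),
        dotProduct_comm _ (fun i => (l₂ i : ℝ))] at hl
      have := hpol l₁ k hl₁ hk
      have := hpol l₂ k hl₂ hk
      linarith
    obtain ⟨k₁, k₂, hk₁, hk₂, hk⟩ := exists_int_rounding hs u (E *ᵥ v) hu hu1
    rw [dotProduct_comm, dotProduct_comm _ (fun i => (k₁ i : ℝ)),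
      dotProduct_comm _ (fun i => (k₂ i : ℝ)), hE (fun i => (k₁ i : ℝ)) v,
      hE (fun i => (k₂ i : ℝ)) v] at hk
    have h1 := hone k₁ hk₁
    have h2 := hone k₂ hk₂
    have h3 := mul_le_mul_of_nonneg_left hk hσ0.le
    have h4 : s * (u ⬝ᵥ E *ᵥ v) ≤ s * (2 * ε) := by
      have : √(s : ℝ) * (√(s : ℝ) * (u ⬝ᵥ E *ᵥ v)) = s * (u ⬝ᵥ E *ᵥ v) := by
        rw [← mul_assoc, ← pow_two, hσ]
      linarith
    exact le_of_mul_le_mul_left h4 hs0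
  have hnorm : ∀ u : Fin p → ℝ, mixedNorm s u ≠ 0 →
      ((mixedNorm s u)⁻¹ • u) ⬝ᵥ ((mixedNorm s u)⁻¹ • u) ≤ 1 ∧
      l1norm ((mixedNorm s u)⁻¹ • u) ≤ √(s : ℝ) := by
    intro u hu
    have hpos : 0 < mixedNorm s u := lt_of_le_of_ne (mixedNorm_nonneg s u) hu.symm
    have hl1 := div_nonneg (l1norm_nonneg u) hσ0.le
    have hl2 := l2norm_nonneg u
    constructor
    · rw [← l2norm_sq, l2norm_smul, abs_of_pos (inv_pos.2 hpos)]
      apply pow_le_one₀ (by positivity)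
      rw [inv_mul_le_iff₀ hpos]
      unfold mixedNorm; linarith
    · rw [l1norm_smul, abs_of_pos (inv_pos.2 hpos), inv_mul_le_iff₀ hpos]
      have : l1norm u / √(s : ℝ) ≤ mixedNorm s u := by unfold mixedNorm; linarith
      rwa [div_le_iff₀ hσ0] at this
  have hzero : ∀ u : Fin p → ℝ, mixedNorm s u = 0 → u = 0 := by
    intro u hu
    have hl1 := div_nonneg (l1norm_nonneg u) hσ0.le
    have hl2 := l2norm_nonneg u
    have h0 : l2norm u = 0 := by unfold mixedNorm at hu; linarith
    exact by_contra fun hne => l2norm_ne_zero hne h0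
  by_cases hu : mixedNorm s u = 0
  · simp [hzero u hu, mixedNorm, l2norm, l1norm]
  by_cases hv : mixedNorm s v = 0
  · simp [hzero v hv, mixedNorm, l2norm, l1norm]
  have hNu : 0 < mixedNorm s u := lt_of_le_of_ne (mixedNorm_nonneg s u) (Ne.symm hu)
  have hNv : 0 < mixedNorm s v := lt_of_le_of_ne (mixedNorm_nonneg s v) (Ne.symm hv)
  obtain ⟨a1, a2⟩ := hnorm u hu
  obtain ⟨b1, b2⟩ := hnorm v hv
  have h1 := hunit _ _ a1 a2 b1 b2
  have h2 := hunit (-((mixedNorm s u)⁻¹ • u)) _ (by simpa using a1) (by rwa [l1norm_neg]) b1 b2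
  rw [neg_dotProduct] at h2
  have e : (mixedNorm s u)⁻¹ • u ⬝ᵥ E *ᵥ ((mixedNorm s v)⁻¹ • v)
      = u ⬝ᵥ E *ᵥ v / (mixedNorm s u * mixedNorm s v) := by
    simp only [mulVec_smul, dotProduct_smul, smul_dotProduct, smul_eq_mul]
    field_simp
  have habs : |u ⬝ᵥ E *ᵥ v / (mixedNorm s u * mixedNorm s v)| ≤ 2 * ε := by
    rw [← e]; exact abs_le.2 ⟨by linarith, h1⟩
  rw [abs_div, abs_of_pos (mul_pos hNu hNv), div_le_iff₀ (mul_pos hNu hNv)] at habs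
  linarith

end Net
end MsCCA

namespace MsCCA
open Matrix MeasureTheory ProbabilityTheory
open scoped NNReal ENNReal

/-! ### Exponential moments of Gaussian squares. -/

section ChiSquare

theorem exp_neg_sub_two_mul_sq_le {y : ℝ} (hy : |y| ≤ 1 / 2) : Real.exp (-y - 2 * y ^ 2) ≤ 1 - y := by
  have h := Real.abs_log_sub_add_sum_range_le (x := y) (by linarith) 1
  simp only [Finset.sum_range_one, zero_add, pow_one, Nat.cast_zero, div_one] at h
  have hy' := abs_le.1 hy
  have h2 : |y| ^ (1 + 1) / (1 - |y|) ≤ 2 * y ^ 2 := by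
    rw [div_le_iff₀ (by linarith), show (1 + 1 : ℕ) = 2 from rfl, sq_abs]
    nlinarith [sq_nonneg y]
  have h3 := (abs_le.1 (h.trans h2)).1
  rw [← Real.le_log_iff_exp_le (by linarith)]
  linarith

theorem integrable_exp_mul_sq_gaussianReal {l : ℝ} (hl : l < 1 / 2) :
    Integrable (fun z : ℝ => Real.exp (l * z ^ 2)) (gaussianReal 0 1) ∧
      ∫ z, Real.exp (l * z ^ 2) ∂(gaussianReal 0 1) = (√(1 - 2 * l))⁻¹ := by
  have hden : ∀ z : ℝ, gaussianPDFReal 0 1 z • Real.exp (l * z ^ 2)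
      = (√(2 * Real.pi))⁻¹ * Real.exp (-(1 / 2 - l) * z ^ 2) := fun z => by
    simp only [gaussianPDFReal, smul_eq_mul, NNReal.coe_one, mul_one, sub_zero]
    rw [mul_assoc, ← Real.exp_add]
    congr 2
    ring
  constructor
  · rw [gaussianReal_of_var_ne_zero 0 one_ne_zero,
      integrable_withDensity_iff_integrable_smul' (measurable_gaussianPDF 0 1)
        (ae_of_all _ fun _ => gaussianPDF_lt_top)]
    simp only [toReal_gaussianPDF, hden]
    exact (integrable_exp_neg_mul_sq (by linarith)).const_mul _
  · rw [integral_gaussianReal_eq_integral_smul one_ne_zero]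
    simp only [hden]
    rw [integral_const_mul, integral_gaussian, ← Real.sqrt_inv, ← Real.sqrt_mul (by positivity),
      ← Real.sqrt_inv]
    congr 1
    have : (1 / 2 - l) ≠ 0 := by linarith
    have h2 : (1 - 2 * l) ≠ 0 := by linarith
    have := Real.pi_ne_zero
    field_simp

/-- The exact value is e^{−l}(1 − 2l)^{−1/2}; log(1 − y) ≥ −y − 2y² at y = 2l yields the exponent
4l². -/
theorem integral_exp_centered_sq_le {l : ℝ} (hl : |l| ≤ 1 / 4) :
    Integrable (fun z : ℝ => Real.exp (l * (z ^ 2 - 1))) (gaussianReal 0 1) ∧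
      ∫ z, Real.exp (l * (z ^ 2 - 1)) ∂(gaussianReal 0 1) ≤ Real.exp (4 * l ^ 2) := by
  have hl' := abs_le.1 hl
  obtain ⟨h1, h2⟩ := integrable_exp_mul_sq_gaussianReal (l := l) (by linarith)
  have e : ∀ z : ℝ, Real.exp (l * (z ^ 2 - 1)) = Real.exp (-l) * Real.exp (l * z ^ 2) := fun z => by
    rw [← Real.exp_add]; congr 1; ring
  simp only [e]
  refine ⟨h1.const_mul _, ?_⟩
  rw [integral_const_mul, h2]
  have h3 := exp_neg_sub_two_mul_sq_le (y := 2 * l) (by rw [abs_mul]; norm_num; linarith)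
  have h4 : Real.exp (-l - 4 * l ^ 2) ≤ √(1 - 2 * l) := by
    apply Real.le_sqrt_of_sq_le
    rw [← Real.exp_nat_mul]
    refine le_trans (le_of_eq ?_) h3
    congr 1
    push_cast
    ring
  have hpos : 0 < √(1 - 2 * l) := Real.sqrt_pos.2 (by linarith)
  rw [← div_eq_mul_inv, div_le_iff₀ hpos]
  calc Real.exp (-l) = Real.exp (4 * l ^ 2) * Real.exp (-l - 4 * l ^ 2) := by
        rw [← Real.exp_add]; congr 1; ring
    _ ≤ _ := by gcongr

end ChiSquare

section Mgf
variable {Ω : Type*} [MeasurableSpace Ω] {P : Measure Ω}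

theorem integral_exp_centered_sq_le_of_hasLaw {Y : Ω → ℝ} {a : ℝ≥0} (ha : a ≠ 0)
    (hY : HasLaw Y (gaussianReal 0 a) P) {l : ℝ} (hl : |l| ≤ 1 / 4) :
    Integrable (fun ω => Real.exp (l * (Y ω ^ 2 / a - 1))) P ∧
      ∫ ω, Real.exp (l * (Y ω ^ 2 / a - 1)) ∂P ≤ Real.exp (4 * l ^ 2) := by
  obtain ⟨h1, h2⟩ := integral_exp_centered_sq_le hl
  have ha0 : (0 : ℝ) < a := by positivity
  have hZ : HasLaw (fun ω => Y ω / √(a : ℝ)) (gaussianReal 0 1) P := by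
    have hm : HasLaw (fun y : ℝ => y / √(a : ℝ)) (gaussianReal 0 1) (gaussianReal 0 a) := by
      refine ⟨by fun_prop, ?_⟩
      rw [gaussianReal_map_div_const]
      congr 1
      · simp
      · ext
        simp [Real.sq_sqrt ha0.le, ha0.ne']
    exact hm.comp hY
  have e : (fun ω => Real.exp (l * (Y ω ^ 2 / a - 1)))
      = (fun z : ℝ => Real.exp (l * (z ^ 2 - 1))) ∘ (fun ω => Y ω / √(a : ℝ)) := by
    ext ω
    simp [div_pow, Real.sq_sqrt ha0.le]
  rw [e]
  constructor
  · rw [← hZ.map_eq] at h1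
    exact h1.comp_aemeasurable hZ.aemeasurable
  · rw [hZ.integral_comp (by fun_prop)]
    exact h2

/-- The moment generating function of a sum of squares of arbitrarily dependent centred Gaussian
variables is at most that of a single square with the same mean. -/
theorem integral_exp_sum_sq_le [IsProbabilityMeasure P] {ι : Type*} [Fintype ι] {Y : ι → Ω → ℝ} {a : ι → ℝ≥0}
    (hY : ∀ d, HasLaw (Y d) (gaussianReal 0 (a d)) P) {l q : ℝ} (hq : ∑ d, (a d : ℝ) = q)
    (hl : |l * q| ≤ 1 / 4) :
    Integrable (fun ω => Real.exp (l * (∑ d, Y d ω ^ 2 - q))) P ∧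
      ∫ ω, Real.exp (l * (∑ d, Y d ω ^ 2 - q)) ∂P ≤ Real.exp (4 * (l * q) ^ 2) := by
  have hq0 : 0 ≤ q := hq ▸ Finset.sum_nonneg fun d _ => (a d).2
  -- Degenerate variables vanish almost surely, so the junk value of division by `a d = 0` below is
  -- harmless.
  have hYae : ∀ᵐ ω ∂P, ∀ d, a d = 0 → Y d ω = 0 := by
    rw [ae_all_iff]
    intro d
    by_cases hd : a d = 0
    · have h := hY d
      rw [hd, gaussianReal_zero_var] at h
      filter_upwards [h.ae_eq_of_dirac] with ω hω _ using hω
    · exact ae_of_all _ fun ω h => absurd h hd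
  have hmeas : AEStronglyMeasurable (fun ω => Real.exp (l * (∑ d, Y d ω ^ 2 - q))) P := by
    have : ∀ d, AEMeasurable (Y d) P := fun d => (hY d).aemeasurable
    exact AEMeasurable.aestronglyMeasurable (by fun_prop)
  -- The Jensen bound: ∑ Y_d² − q is q times the average, with weights a_d/q, of the normalized
  -- centred squares. No joint law is needed.
  set Φ : Ω → ℝ := fun ω => ∑ d, (a d : ℝ) / q * Real.exp (l * q * (Y d ω ^ 2 / a d - 1)) with hΦ
  by_cases hq00 : q = 0
  · have ha : ∀ d, a d = 0 := fun d => by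
      have := (Finset.sum_eq_zero_iff_of_nonneg fun d _ => (a d).2).1 (hq.trans hq00) d
        (Finset.mem_univ d)
      exact NNReal.coe_eq_zero.1 this
    have e : (fun ω => Real.exp (l * (∑ d, Y d ω ^ 2 - q))) =ᵐ[P] fun _ => 1 := by
      filter_upwards [hYae] with ω hω
      simp [hω _ (ha _), hq00]
    rw [integrable_congr e, integral_congr_ae e]
    simp [hq00]
  have hqpos : 0 < q := lt_of_le_of_ne hq0 (Ne.symm hq00)
  have hle : (fun ω => Real.exp (l * (∑ d, Y d ω ^ 2 - q))) ≤ᵐ[P] Φ := by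
    filter_upwards [hYae] with ω hω
    have hj := convexOn_exp.map_sum_le (t := Finset.univ) (w := fun d => (a d : ℝ) / q)
      (p := fun d => l * q * (Y d ω ^ 2 / a d - 1)) (fun d _ => div_nonneg (a d).2 hq0)
      (by rw [← Finset.sum_div, hq, div_self hq00]) (fun _ _ => Set.mem_univ _)
    simp only [smul_eq_mul] at hj
    refine le_trans (le_of_eq ?_) hj
    congr 1
    rw [← hq, ← Finset.sum_sub_distrib, Finset.mul_sum, hq]
    refine Finset.sum_congr rfl fun d _ => ?_
    by_cases hd : a d = 0
    · simp [hd, hω d hd]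
    · have : (a d : ℝ) ≠ 0 := by exact_mod_cast hd
      field_simp
  have hterm : ∀ d, Integrable (fun ω => (a d : ℝ) / q * Real.exp (l * q * (Y d ω ^ 2 / a d - 1))) P ∧
      ∫ ω, (a d : ℝ) / q * Real.exp (l * q * (Y d ω ^ 2 / a d - 1)) ∂P
        ≤ (a d : ℝ) / q * Real.exp (4 * (l * q) ^ 2) := fun d => by
    by_cases hd : a d = 0
    · simp [hd]
    · obtain ⟨h1, h2⟩ := integral_exp_centered_sq_le_of_hasLaw hd (hY d) hl
      refine ⟨h1.const_mul _, ?_⟩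
      rw [integral_const_mul]
      exact mul_le_mul_of_nonneg_left h2 (div_nonneg (a d).2 hq0)
  have hΦint : Integrable Φ P := integrable_finsetSum _ fun d _ => (hterm d).1
  have hexpInt : Integrable (fun ω => Real.exp (l * (∑ d, Y d ω ^ 2 - q))) P := by
    refine hΦint.mono' hmeas ?_
    filter_upwards [hle] with ω hω
    rw [Real.norm_of_nonneg (Real.exp_nonneg _)]
    exact hω
  refine ⟨hexpInt, (integral_mono_ae hexpInt hΦint hle).trans ?_⟩
  rw [hΦ, integral_finsetSum _ fun d _ => (hterm d).1]
  calc _ ≤ ∑ d, (a d : ℝ) / q * Real.exp (4 * (l * q) ^ 2) :=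
        Finset.sum_le_sum fun d _ => (hterm d).2
    _ = Real.exp (4 * (l * q) ^ 2) := by
        rw [← Finset.sum_mul, ← Finset.sum_div, hq, div_self hq00, one_mul]

/-- Two-sided Chernoff bound for a sum of independent variables with sub-Gaussian moment
generating functions near zero. -/
theorem measure_abs_sum_ge_le [IsProbabilityMeasure P] {n : ℕ} {W : Fin n → Ω → ℝ} (hind : iIndepFun W P)
    (hmeas : ∀ k, AEMeasurable (W k) P) {A τ : ℝ} (hA : 0 < A) (hτ : 0 ≤ τ) (hτ1 : τ ≤ 2)
    (hW : ∀ k, ∀ l : ℝ, |l| * A ≤ 1 / 4 → Integrable (fun ω => Real.exp (l * W k ω)) P ∧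
      mgf (W k) P l ≤ Real.exp (4 * (l * A) ^ 2)) :
    P {ω | n * (A * τ) ≤ |∑ k, W k ω|} ≤ ENNReal.ofReal (2 * Real.exp (-(n * τ ^ 2 / 16))) := by
  have hmgf : ∀ l : ℝ, |l| * A ≤ 1 / 4 →
      Integrable (fun ω => Real.exp (l * (∑ k, W k) ω)) P ∧
      mgf (∑ k, W k) P l ≤ Real.exp (n * (4 * (l * A) ^ 2)) := by
    intro l hl
    have h1 := hind.mgf_sum₀ hmeas Finset.univ (t := l)
    constructor
    · rw [← mgf_pos_iff, h1]
      exact Finset.prod_pos fun k _ => mgf_pos (hW k l hl).1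
    · rw [h1, Real.exp_nat_mul]
      refine (Finset.prod_le_prod (fun k _ => mgf_nonneg) fun k _ => (hW k l hl).2).trans ?_
      simp
  -- The minimizer of −tAτ + 4(tA)², with value −τ²/16; τ ≤ 2 keeps it in the admissible range tA ≤
  -- 1/4.
  set t := τ / (8 * A) with ht
  have ht0 : 0 ≤ t := by positivity
  have htA : t * A = τ / 8 := by rw [ht]; field_simp
  have habs : |t| * A ≤ 1 / 4 := by rw [abs_of_nonneg ht0, htA]; linarith
  have habs' : |-t| * A ≤ 1 / 4 := by rwa [abs_neg]
  have hexp : Real.exp (-t * (n * (A * τ))) * Real.exp (n * (4 * (t * A) ^ 2))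
      = Real.exp (-(n * τ ^ 2 / 16)) := by
    rw [← Real.exp_add]
    congr 1
    have : -t * (n * (A * τ)) = -(n * (t * A) * τ) := by ring
    rw [this, htA]; ring
  have hup : P.real {ω | n * (A * τ) ≤ (∑ k, W k) ω} ≤ Real.exp (-(n * τ ^ 2 / 16)) := by
    refine (measure_ge_le_exp_mul_mgf _ ht0 (hmgf t habs).1).trans ?_
    rw [← hexp]
    gcongr
    exact (hmgf t habs).2
  have hlo : P.real {ω | (∑ k, W k) ω ≤ -(n * (A * τ))} ≤ Real.exp (-(n * τ ^ 2 / 16)) := by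
    refine (measure_le_le_exp_mul_mgf _ (neg_nonpos.2 ht0) (hmgf (-t) habs').1).trans ?_
    rw [← hexp, neg_neg, mul_neg, ← neg_mul]
    gcongr
    refine (hmgf (-t) habs').2.trans (le_of_eq ?_)
    ring_nf
  have hsub : {ω | n * (A * τ) ≤ |∑ k, W k ω|}
      ⊆ {ω | n * (A * τ) ≤ (∑ k, W k) ω} ∪ {ω | (∑ k, W k) ω ≤ -(n * (A * τ))} := by
    intro ω hω
    simp only [Set.mem_ofPred_eq, Finset.sum_apply, Set.mem_union] at hω ⊢
    rcases le_abs.1 hω with h | h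
    · exact Or.inl h
    · exact Or.inr (by linarith)
  refine (measure_mono hsub).trans ((measure_union_le _ _).trans ?_)
  rw [two_mul, ENNReal.ofReal_add (Real.exp_nonneg _) (Real.exp_nonneg _)]
  gcongr
  · rw [← ofReal_measureReal]; exact ENNReal.ofReal_le_ofReal hup
  · rw [← ofReal_measureReal]; exact ENNReal.ofReal_le_ofReal hlo

end Mgf
end MsCCA

namespace MsCCA
open Matrix MeasureTheory ProbabilityTheory
open scoped NNReal ENNReal

/-! ### Uniform concentration of the empirical covariance. -/

section Sample
variable {Ω : Type*} [MeasurableSpace Ω] {P : Measure Ω} {n p D : ℕ}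

theorem hasLaw_dotProduct {S : Matrix (Fin p) (Fin p) ℝ} (hS : S.PosSemidef) {x : Ω → Fin p → ℝ}
    (hx : HasLaw (fun ω => WithLp.toLp 2 (x ω)) (multivariateGaussian 0 S) P) (w : Fin p → ℝ) :
    HasLaw (fun ω => x ω ⬝ᵥ w) (gaussianReal 0 (w ⬝ᵥ S *ᵥ w).toNNReal) P := by
  have hL : HasLaw (innerSL ℝ (WithLp.toLp 2 w)) (gaussianReal 0 (w ⬝ᵥ S *ᵥ w).toNNReal)
      (multivariateGaussian 0 S) := by
    refine ⟨by fun_prop, ?_⟩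
    rw [IsGaussian.map_eq_gaussianReal]
    congr 1
    · rw [ContinuousLinearMap.integral_comp_id_comm IsGaussian.integrable_id]
      simp
    · have h := covarianceBilin_multivariateGaussian (μ := 0) hS (WithLp.toLp 2 w) (WithLp.toLp 2 w)
      rw [covarianceBilin_self IsGaussian.memLp_two_id] at h
      congr 1
  have h := hL.comp hx
  refine h.congr (Filter.Eventually.of_forall fun ω => ?_)
  simp [EuclideanSpace.inner_toLp_toLp]

theorem dotProduct_empCov (X : Matrix (Fin n) (Fin p) ℝ) (w : Fin p → ℝ) :
    w ⬝ᵥ empCov X *ᵥ w = (n : ℝ)⁻¹ * ∑ k, (X k ⬝ᵥ w) ^ 2 := by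
  rw [empCov, smul_mulVec, dotProduct_smul, smul_eq_mul, ← mulVec_mulVec, dotProduct_mulVec,
    vecMul_transpose]
  congr 1
  exact Finset.sum_congr rfl fun k _ => (pow_two _).symm

theorem empCov_isHermitian (X : Matrix (Fin n) (Fin p) ℝ) : (empCov X).IsHermitian := by
  rw [IsHermitian, conjTranspose_eq_transpose_of_trivial, empCov, transpose_smul, transpose_mul,
    transpose_transpose]

/-- Concentration of a block-diagonal empirical quadratic form at a fixed vector. -/
theorem measure_abs_quad_sub_ge_le [IsProbabilityMeasure P] (hn : 1 ≤ n) (blk : Fin p → Fin D)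
    {S : Matrix (Fin p) (Fin p) ℝ} (hS : S.PosSemidef) {X : Ω → Matrix (Fin n) (Fin p) ℝ}
    (hX : IsGaussianSample P S X) {A τ : ℝ} (hA : 0 < A) (hτ : 0 ≤ τ) (hτ1 : τ ≤ 2)
    {u : Fin p → ℝ} (hu : u ⬝ᵥ blockDiag blk S *ᵥ u ≤ A) :
    P {ω | A * τ ≤ |u ⬝ᵥ blockDiag blk (empCov (X ω)) *ᵥ u - u ⬝ᵥ blockDiag blk S *ᵥ u|}
      ≤ ENNReal.ofReal (2 * Real.exp (-(n * τ ^ 2 / 16))) := by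
  have hn0 : (0 : ℝ) < n := by exact_mod_cast hn
  set q := u ⬝ᵥ blockDiag blk S *ᵥ u with hq
  have hd0 : ∀ d, 0 ≤ mask blk d u ⬝ᵥ S *ᵥ mask blk d u := fun d => by
    simpa using hS.dotProduct_mulVec_nonneg (mask blk d u)
  have hqs : ∑ d, (((mask blk d u ⬝ᵥ S *ᵥ mask blk d u).toNNReal : ℝ≥0) : ℝ) = q := by
    rw [hq, dotProduct_blockDiag]
    exact Finset.sum_congr rfl fun d _ => Real.coe_toNNReal _ (hd0 d)
  have hq0 : 0 ≤ q := hqs ▸ Finset.sum_nonneg fun d _ => NNReal.coe_nonneg _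
  -- The centred contribution of a single observation; independence is used only across
  -- observations.
  set F : (Fin p → ℝ) → ℝ := fun x => ∑ d, (x ⬝ᵥ mask blk d u) ^ 2 - q with hF
  have hFm : Measurable F := by
    simp only [hF, dotProduct]; fun_prop
  have hXm : ∀ k, AEMeasurable (fun ω => X ω k) P := fun k =>
    (WithLp.measurable_ofLp 2 (Fin p → ℝ)).comp_aemeasurable (hX.law k).aemeasurable
  have hind : iIndepFun (fun k ω => F (X ω k)) P := hX.indep.comp (fun _ => F) fun _ => hFm
  have hmgf : ∀ k, ∀ l : ℝ, |l| * A ≤ 1 / 4 →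
      Integrable (fun ω => Real.exp (l * F (X ω k))) P ∧
      mgf (fun ω => F (X ω k)) P l ≤ Real.exp (4 * (l * A) ^ 2) := by
    intro k l hl
    have hlq : |l * q| ≤ 1 / 4 := by
      rw [abs_mul, abs_of_nonneg hq0]
      exact (mul_le_mul_of_nonneg_left hu (abs_nonneg l)).trans hl
    obtain ⟨h1, h2⟩ := integral_exp_sum_sq_le
      (fun d => hasLaw_dotProduct hS (hX.law k) (mask blk d u)) hqs hlq
    refine ⟨h1, h2.trans (Real.exp_le_exp.2 ?_)⟩
    rw [mul_pow, mul_pow]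
    gcongr
  have key := measure_abs_sum_ge_le hind (fun k => hFm.comp_aemeasurable (hXm k)) hA hτ hτ1 hmgf
  refine le_trans (measure_mono fun ω hω => ?_) key
  simp only [Set.mem_ofPred_eq] at hω ⊢
  have e : ∑ k, F (X ω k) = n * (u ⬝ᵥ blockDiag blk (empCov (X ω)) *ᵥ u - q) := by
    rw [dotProduct_blockDiag]
    simp only [dotProduct_empCov, hF, Finset.sum_sub_distrib, Finset.sum_const, Finset.card_univ,
      Fintype.card_fin, nsmul_eq_mul, ← Finset.mul_sum]
    rw [Finset.sum_comm]
    field_simp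
  rw [e, abs_mul, abs_of_pos hn0]
  gcongr

/-- Uniform concentration of a block-diagonal empirical covariance in the mixed norm. -/
theorem measure_not_uniform_le [IsProbabilityMeasure P] {s : ℕ} (hn : 1 ≤ n) (hp : 2 ≤ p)
    (hs : 1 ≤ s) (blk : Fin p → Fin D) {S : Matrix (Fin p) (Fin p) ℝ} (hS : S.PosSemidef)
    {X : Ω → Matrix (Fin n) (Fin p) ℝ} (hX : IsGaussianSample P S X) {A : ℝ} (hA : 0 < A)
    (hSA : ∀ u, u ⬝ᵥ blockDiag blk S *ᵥ u ≤ A * (u ⬝ᵥ u)) (hr : 8 * √(rate s p n) ≤ 1) :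
    P {ω | ¬ ∀ u v, |u ⬝ᵥ blockDiag blk (empCov (X ω)) *ᵥ v - u ⬝ᵥ blockDiag blk S *ᵥ v|
        ≤ 128 * A * √(rate s p n) * mixedNorm s u * mixedNorm s v}
      ≤ ENNReal.ofReal (2 / p) := by
  have hn0 : (0 : ℝ) < n := by exact_mod_cast hn
  have hp0 : (0 : ℝ) < p := by exact_mod_cast (by omega : 0 < p)
  have hs1 : (1 : ℝ) ≤ s := by exact_mod_cast hs
  have hlog : 0 ≤ Real.log p := Real.log_natCast_nonneg p
  set r := √(rate s p n) with hrdef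
  have hr0 : 0 ≤ r := Real.sqrt_nonneg _
  have hr2 : n * r ^ 2 = s * Real.log p := by
    rw [hrdef, Real.sq_sqrt (by unfold rate; positivity), rate]; field_simp
  set N := (intNet p (4 * s)).filter (fun k => ∑ i, k i ^ 2 ≤ (4 * s : ℤ)) with hN
  set bad : (Fin p → ℤ) → Set Ω := fun k =>
    {ω | 4 * s * A * (16 * r) ≤ |(fun i => (k i : ℝ)) ⬝ᵥ blockDiag blk (empCov (X ω)) *ᵥ (fun i => (k i : ℝ))
      - (fun i => (k i : ℝ)) ⬝ᵥ blockDiag blk S *ᵥ (fun i => (k i : ℝ))|} with hbad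
  have hsub : {ω | ¬ ∀ u v, |u ⬝ᵥ blockDiag blk (empCov (X ω)) *ᵥ v - u ⬝ᵥ blockDiag blk S *ᵥ v|
        ≤ 128 * A * r * mixedNorm s u * mixedNorm s v} ⊆ ⋃ k ∈ N, bad k := by
    intro ω hω
    by_contra hcon
    refine hω fun u v => ?_
    have hE : ∀ u v, u ⬝ᵥ (blockDiag blk (empCov (X ω)) - blockDiag blk S) *ᵥ v
        = u ⬝ᵥ blockDiag blk (empCov (X ω)) *ᵥ v - u ⬝ᵥ blockDiag blk S *ᵥ v := fun u v => by
      rw [sub_mulVec, dotProduct_sub]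
    have h1 := bilin_comm_of_isHermitian (blockDiag_isHermitian blk (empCov_isHermitian (X ω)))
    have h2 := bilin_comm_of_isHermitian (blockDiag_isHermitian blk hS.isHermitian)
    -- The factor 4 in `ε` is the squared norm 4s of the net vectors divided by s; doubling `ε`
    -- gives the constant 128.
    have key := abs_bilin_le_of_intNet hs (ε := 4 * A * (16 * r))
      (fun u v => by rw [hE, hE, h1 u v, h2 u v]) (fun k hk => by
        rw [hE]
        by_contra hlt
        refine hcon (Set.mem_biUnion (x := k) ?_ ?_)
        · simp only [hN, Finset.coe_filter]
          exact ⟨mem_intNet_of_sum_sq_le (by exact_mod_cast hk), hk⟩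
        · simp only [hbad, Set.mem_ofPred_eq]
          linarith [not_le.1 hlt]) u v
    rw [hE] at key
    linarith
  -- The deviation τ = 16r gives exponent nτ²/16 = 16 s ln p, and `8 * r ≤ 1` is the requirement τ ≤
  -- 2.
  have hone : ∀ k ∈ N, P (bad k) ≤ ENNReal.ofReal (2 * Real.exp (-(16 * (s * Real.log p)))) := by
    intro k hk
    have hk2 : ∑ i, k i ^ 2 ≤ (4 * s : ℤ) := (Finset.mem_filter.1 hk).2
    have hkk : (fun i => (k i : ℝ)) ⬝ᵥ (fun i => (k i : ℝ)) ≤ 4 * s := by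
      have : ((∑ i, k i ^ 2 : ℤ) : ℝ) ≤ ((4 * s : ℤ) : ℝ) := by exact_mod_cast hk2
      push_cast at this
      simpa [dotProduct, pow_two] using this
    have := measure_abs_quad_sub_ge_le hn blk hS hX (A := 4 * s * A) (τ := 16 * r) (by positivity)
      (by positivity) (by linarith) (u := fun i => (k i : ℝ)) (by
        refine (hSA _).trans ?_
        calc A * _ ≤ A * (4 * s) := by gcongr
          _ = _ := by ring)
    refine this.trans (le_of_eq ?_)
    congr 3
    rw [← hr2]; ring
  -- As 2p + 1 ≤ p³ for p ≥ 2, the union bound costs 12 s ln p, leaving exponent −4 s ln p ≤ −ln p.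
  have hcard : (N.card : ℝ) ≤ Real.exp (12 * (s * Real.log p)) := by
    have h1 : N.card ≤ (2 * p + 1) ^ (4 * s) :=
      (Finset.card_filter_le _ _).trans (card_intNet_le p (4 * s))
    have h2 : 2 * p + 1 ≤ p ^ 3 := by nlinarith [Nat.mul_le_mul hp hp]
    have h3 : N.card ≤ p ^ (12 * s) := by
      refine h1.trans ((Nat.pow_le_pow_left h2 _).trans (le_of_eq ?_))
      rw [← pow_mul]; congr 1; ring
    have h4 : Real.exp (12 * (s * Real.log p)) = (p : ℝ) ^ (12 * s) := by
      rw [← Real.exp_log hp0, ← Real.exp_nat_mul, Real.exp_log hp0]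
      congr 1
      push_cast
      ring
    rw [h4]
    exact_mod_cast h3
  calc _ ≤ P (⋃ k ∈ N, bad k) := measure_mono hsub
    _ ≤ ∑ k ∈ N, P (bad k) := measure_biUnion_finset_le _ _
    _ ≤ ∑ k ∈ N, ENNReal.ofReal (2 * Real.exp (-(16 * (s * Real.log p)))) := Finset.sum_le_sum hone
    _ = ENNReal.ofReal (N.card * (2 * Real.exp (-(16 * (s * Real.log p))))) := by
        rw [Finset.sum_const, nsmul_eq_mul, ENNReal.ofReal_mul (Nat.cast_nonneg _),
          ENNReal.ofReal_natCast]
    _ ≤ ENNReal.ofReal (2 / p) := by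
        apply ENNReal.ofReal_le_ofReal
        calc N.card * (2 * Real.exp (-(16 * (s * Real.log p))))
            ≤ Real.exp (12 * (s * Real.log p)) * (2 * Real.exp (-(16 * (s * Real.log p)))) := by
              gcongr
          _ = 2 * Real.exp (-(4 * (s * Real.log p))) := by
              rw [mul_left_comm, ← Real.exp_add]; congr 2; ring
          _ ≤ 2 * Real.exp (-Real.log p) := by
              gcongr
              nlinarith
          _ = 2 / p := by rw [Real.exp_neg, Real.exp_log hp0]; ring

end Sample
-- Error bound along a whole run.
section Run
variable {p : ℕ}

namespace IsLeadingPair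
variable {M γ ρ : ℝ} {S Lam : Matrix (Fin p) (Fin p) ℝ} {ξ : Fin p → ℝ}

/-- After choosing the sign, ‖β − ξ‖² = 2(1 − |βᵀξ|), and the excess is at most M times this. -/
theorem excess_le_disc (h : IsLeadingPair M γ ρ S Lam ξ) {β : Fin p → ℝ} (hβ : IsUnitVec β) :
    excess ρ S Lam β ≤ 2 * M * disc ξ β := by
  have key : ∀ ζ : Fin p → ℝ, IsLeadingPair M γ ρ S Lam ζ →
      excess ρ S Lam β ≤ 2 * M * (1 - β ⬝ᵥ ζ) := by
    intro ζ hζ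
    have h1 := hζ.excess_le (β - ζ)
    have hu := hζ.unit
    unfold IsUnitVec at hu hβ
    rw [hζ.excess_sub, sub_dotProduct, dotProduct_sub, dotProduct_sub, hu, hβ,
      dotProduct_comm ζ β] at h1
    linarith
  rcases abs_cases (β ⬝ᵥ ξ) with ⟨he, -⟩ | ⟨he, -⟩
  · rw [disc, he]; exact key ξ h
  · have := key (-ξ) h.neg
    rwa [dotProduct_neg, ← he] at this

/-- The eigengap combined with 1 − c ≤ 1 − c² for 0 ≤ c ≤ 1. -/
theorem disc_le_excess (h : IsLeadingPair M γ ρ S Lam ξ) (hγ : 0 < γ) {β : Fin p → ℝ}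
    (hβ : IsUnitVec β) : disc ξ β ≤ M / γ * excess ρ S Lam β := by
  have hg := h.gap β hβ
  have hu := h.unit
  have h1 := dotProduct_self_nonneg' (β - ξ)
  have h2 := dotProduct_self_nonneg' (β + ξ)
  unfold IsUnitVec at hu hβ
  simp only [sub_dotProduct, dotProduct_sub, add_dotProduct, dotProduct_add, hu, hβ,
    dotProduct_comm ξ β] at h1 h2
  have hc : |β ⬝ᵥ ξ| ≤ 1 := abs_le.2 ⟨by linarith, by linarith⟩
  rw [div_mul_eq_mul_div, le_div_iff₀ hγ]
  refine le_trans ?_ hg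
  rw [mul_comm]
  gcongr
  rw [disc, ← sq_abs]
  nlinarith [abs_nonneg (β ⬝ᵥ ξ)]

end IsLeadingPair

theorem one_le_l0norm {ξ : Fin p → ℝ} (h : IsUnitVec ξ) : 1 ≤ l0norm ξ := by
  have hne : ξ ≠ 0 := by rintro rfl; simp [IsUnitVec] at h
  obtain ⟨i, hi⟩ := Function.ne_iff.1 hne
  exact (Set.ncard_pos (Set.toFinite _)).2 ⟨i, hi⟩

/-- The supremum may be infinite, so it need not be attained; some later index meeting the threshold
suffices because the bounds decrease. Time 0 is excluded, the supremum of the empty set being 0. -/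
theorem exists_ge_of_le_stopTime {c₁ c₂ ν : ℝ} {s n t : ℕ} {B : ℕ → ℝ}
    (h : ((t + 1 : ℕ) : ℕ∞) ≤ stopTime c₁ c₂ ν s p n B) :
    ∃ t', t + 1 ≤ t' ∧ 4 * c₂ * (1 + c₁) / ν * √((s : ℝ) ^ 2 * Real.log p / n) ≤ B t' := by
  have h1 : (t : ℕ∞) < stopTime c₁ c₂ ν s p n B :=
    lt_of_lt_of_le (by exact_mod_cast Nat.lt_succ_self t) h
  unfold stopTime at h1
  obtain ⟨t', h2⟩ := lt_iSup_iff.1 h1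
  obtain ⟨h3, h4⟩ := lt_iSup_iff.1 h2
  exact ⟨t', by exact_mod_cast h4, h3⟩

theorem bound_antitone {c₁ c₂ η Linf : ℝ} {s n : ℕ} (hc : 0 ≤ c₂ * η)
    (hr : c₂ * η * √(rate s p n) ≤ 1) (hL : Linf ≤ (1 + c₁) * √(s : ℝ)) :
    Antitone (bound c₁ c₂ η Linf s p n) := by
  have h0 : 0 ≤ c₂ * η * √(rate s p n) := mul_nonneg hc (Real.sqrt_nonneg _)
  intro a b hab
  unfold bound
  gcongr Linf + ?_ * _
  exact pow_le_pow_of_le_one (by linarith) (by linarith) hab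

/-- Caps the absolute decrease of L_t. Compared with the threshold defining T*, it becomes a cap on
the relative decrease of the slack. -/
theorem bound_sub_bound_succ_le {c₁ c₂ η Linf : ℝ} {s n : ℕ} (hc : 0 ≤ c₂ * η)
    (hr : c₂ * η * √(rate s p n) ≤ 1) (hL : Linf ≤ (1 + c₁) * √(s : ℝ)) (hL0 : 0 ≤ Linf) (t : ℕ) :
    bound c₁ c₂ η Linf s p n t - bound c₁ c₂ η Linf s p n (t + 1)
      ≤ c₂ * η * √(rate s p n) * ((1 + c₁) * √(s : ℝ)) := by
  have h0 : 0 ≤ c₂ * η * √(rate s p n) := mul_nonneg hc (Real.sqrt_nonneg _)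
  have hp : (1 - c₂ * η * √(rate s p n)) ^ t ≤ 1 := pow_le_one₀ (by linarith) (by linarith)
  have e : bound c₁ c₂ η Linf s p n t - bound c₁ c₂ η Linf s p n (t + 1)
      = (1 - c₂ * η * √(rate s p n)) ^ t * (c₂ * η * √(rate s p n))
        * ((1 + c₁) * √(s : ℝ) - Linf) := by
    unfold bound; rw [pow_succ]; ring
  rw [e]
  have h1 : 0 ≤ (1 + c₁) * √(s : ℝ) - Linf := by linarith
  calc _ ≤ 1 * (c₂ * η * √(rate s p n)) * ((1 + c₁) * √(s : ℝ) - Linf) := by gcongr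
    _ ≤ 1 * (c₂ * η * √(rate s p n)) * ((1 + c₁) * √(s : ℝ)) := by gcongr; linarith
    _ = _ := by ring

/-- The error bound for all runs of the algorithm, on the event that the empirical matrices are
close to the population matrices. -/
theorem exists_disc_bound {M γ c₀ η c₁ c₂ K : ℝ} (hM : 1 ≤ M) (hγ : 0 < γ) (hγ1 : γ ≤ 1)
    (hc₀ : 0 < c₀) (hc₀' : c₀ < 1) (hη : 0 < η) (hηM : 8 * M * η ≤ 1) (hc₁ : 0 < c₁)
    (hc₂ : 0 < c₂) (hK : 0 < K) :
    ∃ ψ₁ > (0 : ℝ), ∃ ψ₂ > (0 : ℝ), ∃ r₁ > (0 : ℝ),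
    ∀ (p n : ℕ) (ρ ν Linf : ℝ) (S Lam Sh Lh : Matrix (Fin p) (Fin p) ℝ) (ξ : Fin p → ℝ)
      (L B : ℕ → ℝ) (β : ℕ → Fin p → ℝ),
    IsLeadingPair M γ ρ S Lam ξ →
    (∀ u v, |u ⬝ᵥ Sh *ᵥ v - u ⬝ᵥ S *ᵥ v|
      ≤ ρ * (K * √(rate (l0norm ξ) p n) * mixedNorm (l0norm ξ) u * mixedNorm (l0norm ξ) v)) →
    (∀ u v, |u ⬝ᵥ Lh *ᵥ v - u ⬝ᵥ Lam *ᵥ v|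
      ≤ K * √(rate (l0norm ξ) p n) * mixedNorm (l0norm ξ) u * mixedNorm (l0norm ξ) v) →
    √(rate (l0norm ξ) p n) ≤ r₁ → 0 ≤ Linf → Linf ≤ (1 + c₁) * √(l0norm ξ : ℝ) →
    (∀ t, L t = bound c₁ c₂ η Linf (l0norm ξ) p n t) → ν = (1 - c₀) * γ ^ 2 / M →
    (∀ t, B t = L t - l1norm ξ) →
    IsUnitVec (β 0) → l1norm (β 0) ≤ L 0 → disc ξ (β 0) ≤ ψ₁ → IsProximalRun Sh Lh η L β →
    ∀ t : ℕ, (t : ℕ∞) ≤ stopTime c₁ c₂ ν (l0norm ξ) p n B →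
      disc ξ (β t) ≤ ψ₂ * (disc ξ (β 0) * (1 - η * ν) ^ t + rate (l0norm ξ) p n
        + √(rate (l0norm ξ) p n) * (B t / √(l0norm ξ : ℝ) + B t ^ 2 / (l0norm ξ : ℝ))) := by
  have hM0 : 0 < M := by linarith
  have hc₀1 : 0 < 1 - c₀ := by linarith
  have hν0 : 0 < (1 - c₀) * γ ^ 2 / M := by positivity
  -- The constant in T*: for the normalized slack b = B/√s, the threshold reads b ≥ kr.
  obtain ⟨k, hk⟩ : ∃ k, k = 4 * c₂ * (1 + c₁) / ((1 - c₀) * γ ^ 2 / M) := ⟨_, rfl⟩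
  have hk0 : 0 < k := by rw [hk]; positivity
  obtain ⟨q₀, hq₀, r₀, hr₀, A, hA, hstep⟩ :=
    exists_excess_step hM hγ hγ1 hc₀ hc₀' hη hηM hc₁ hK hk0
  obtain ⟨ω, hω⟩ : ∃ ω, ω = η * ((1 - c₀) * γ ^ 2 / M) := ⟨_, rfl⟩
  have hω0 : 0 < ω := by rw [hω]; positivity
  have hωκ : ω ≤ η * γ / M := by
    rw [hω, ← mul_div_assoc]
    have : (1 - c₀) * γ ^ 2 ≤ γ := by nlinarith [mul_pos hγ hγ, mul_pos hc₀ (mul_pos hγ hγ)]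
    gcongr
  have hη8 : η ≤ 1 / 8 := by nlinarith
  have hω1 : ω ≤ 1 := by
    refine hωκ.trans ?_
    rw [div_le_iff₀ hM0]
    nlinarith
  set C := 2 * A / ω with hC
  have hC0 : 0 < C := by positivity
  -- `min 1 c₁` makes the initial excess at most both q₀/2 and (q₀/2)c₁, where c₁ ≤ b₀ because ‖ξ‖₁
  -- ≤ √s.
  refine ⟨q₀ / (4 * M) * min 1 c₁, by positivity, M / γ * (2 * M + C), by positivity,
    min r₀ (min (1 / (c₂ * η)) (q₀ / 2 / (C * (1 + c₁)))), by positivity, ?_⟩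
  intro p n ρ ν Linf S Lam Sh Lh ξ L B β hpair hSn hLn hr hLinf0 hLinf hLdef hν hB hβ0 hβ01 hδ hrun
    t ht
  have hs := one_le_l0norm hpair.unit
  set s := l0norm ξ with hsdef
  have hs0 : (0 : ℝ) < s := by exact_mod_cast hs
  set σ := √(s : ℝ) with hσ
  have hσ0 : 0 < σ := Real.sqrt_pos.2 hs0
  have hσ2 : σ ^ 2 = s := Real.sq_sqrt hs0.le
  have hrate : 0 ≤ rate s p n := by
    have : 0 ≤ Real.log p := Real.log_natCast_nonneg p
    unfold rate; positivity
  set r := √(rate s p n) with hrdef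
  have hr0 : 0 ≤ r := Real.sqrt_nonneg _
  obtain ⟨hra, hrb, hrc⟩ : r ≤ r₀ ∧ c₂ * η * r ≤ 1 ∧ C * r * (1 + c₁) ≤ q₀ / 2 := by
    have h1 := hr.trans (min_le_left _ _)
    have h2 := (hr.trans (min_le_right _ _)).trans (min_le_left _ _)
    have h3 := (hr.trans (min_le_right _ _)).trans (min_le_right _ _)
    rw [le_div_iff₀ (by positivity)] at h2 h3
    exact ⟨h1, by linarith, by linarith⟩
  have hanti : Antitone L := by
    have : L = bound c₁ c₂ η Linf s p n := funext hLdef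
    rw [this]; exact bound_antitone (by positivity) hrb hLinf
  have hL0 : L 0 = (1 + c₁) * σ := by rw [hLdef, bound]; simp [hσ]
  have hdiff : ∀ j, L j - L (j + 1) ≤ c₂ * η * r * ((1 + c₁) * σ) := fun j => by
    rw [hLdef, hLdef]; exact bound_sub_bound_succ_le (by positivity) hrb hLinf hLinf0 j
  have hξ1 : l1norm ξ ≤ σ := by
    have h1 := l1norm_le_sqrt_l0norm ξ
    have h2 : l2norm ξ = 1 := by rw [l2norm, hpair.unit, Real.sqrt_one]
    rwa [h2, mul_one] at h1
  obtain ⟨b, hb⟩ : ∃ b : ℕ → ℝ, ∀ j, b j = B j / σ := ⟨_, fun _ => rfl⟩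
  have hbL : ∀ j, l1norm ξ + b j * σ = L j := fun j => by rw [hb, hB]; field_simp; ring
  have hb0 : c₁ ≤ b 0 := by
    rw [hb, hB, hL0, le_div_iff₀ hσ0]; linarith
  have hbc : ∀ j, b j ≤ 1 + c₁ := fun j => by
    have h1 := hanti (Nat.zero_le j)
    rw [hb, hB, div_le_iff₀ hσ0]
    have := l1norm_nonneg ξ
    linarith
  have hthr : ∀ j < t, k * r ≤ b j ∧ k * r ≤ b (j + 1) := by
    intro j hj
    obtain ⟨t₀, rfl⟩ : ∃ t₀, t = t₀ + 1 := ⟨t - 1, by omega⟩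
    obtain ⟨t', ht', hBt⟩ := exists_ge_of_le_stopTime ht
    have hsq : √((s : ℝ) ^ 2 * Real.log p / n) = σ * r := by
      rw [hσ, hrdef, ← Real.sqrt_mul hs0.le]
      congr 1
      unfold rate; ring
    rw [hsq, hν, ← hk] at hBt
    have h1 := hanti (show j ≤ t' by omega)
    have h2 := hanti (show j + 1 ≤ t' by omega)
    rw [hb, hb, hB, hB, le_div_iff₀ hσ0, le_div_iff₀ hσ0]
    rw [hB] at hBt
    constructor <;> linarith
  have hbpos : ∀ j ≤ t, 0 ≤ b j := by
    intro j hj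
    rcases j with _ | j
    · linarith
    · exact le_trans (by positivity) (hthr j (by omega)).2
  have hbdec : ∀ j < t, (1 - ω / 4) * b j ≤ b (j + 1) := by
    intro j hj
    have h1 := (hthr j hj).1
    have h2 := hdiff j
    rw [← hbL, ← hbL] at h2
    have h3 : b j - b (j + 1) ≤ c₂ * η * r * (1 + c₁) := by
      refine le_of_mul_le_mul_right ?_ hσ0
      linarith
    -- The factor 4/ν in T* is chosen so that one decrement of b is at most (ω/4)b.
    have h4 : ω / 4 * (k * r) = c₂ * η * r * (1 + c₁) := by
      rw [hω, hk]; field_simp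
    have h5 : ω / 4 * (k * r) ≤ ω / 4 * b j := by gcongr
    linarith
  have hβu : ∀ j, IsUnitVec (β j) := fun j => by
    rcases j with _ | j
    · exact hβ0
    · exact (hrun j).1.1
  have hβ1 : ∀ j, l1norm (β j) ≤ L j := fun j => by
    rcases j with _ | j
    · exact hβ01
    · exact (hrun j).1.2
  have hQ0 := hpair.excess_le_disc hβ0
  have hψ : 2 * M * disc ξ (β 0) ≤ q₀ / 2 * min 1 c₁ := by
    calc _ ≤ 2 * M * (q₀ / (4 * M) * min 1 c₁) := by gcongr
      _ = _ := by field_simp; ring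
  have hrec := recursion_bound (q := fun j => excess ρ S Lam (β j)) (b := b) (T := t) (c := 1 + c₁)
    hω0 hω1 hA hr0 hb0 hbc hq₀ hbpos hbdec
    ((hQ0.trans hψ).trans (mul_le_of_le_one_right (by positivity) (min_le_left _ _)))
    ((hQ0.trans hψ).trans (mul_le_mul_of_nonneg_left (min_le_right _ _) (by positivity)))
    hrc (le_trans (le_mul_of_one_le_right (by positivity) (by linarith)) hrc)
    (fun j hj hq hqb => by
      have hκb : (1 - η * γ / M / 4) * b j ≤ b (j + 1) := by
        refine le_trans ?_ (hbdec j hj)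
        have := hbpos j hj.le
        gcongr
      have hκσ := mul_le_mul_of_nonneg_right hκb hσ0.le
      rw [hω]
      refine hstep p ρ r (b j) (L (j + 1)) S Lam Sh Lh ξ (β j) (β (j + 1)) hpair hs hSn hLn hr0 hra
        (hthr j hj).1 (hβu j) ?_ ?_ ?_ ?_ hq hqb (hrun j).1 (hrun j).2
      · rw [hbL]; exact hβ1 j
      · rw [hbL, ← hL0]; exact hanti (Nat.zero_le j)
      · rw [hbL]; exact hanti (Nat.le_succ j)
      · rw [← hbL (j + 1)]; linarith) t le_rfl
  have hfin := hpair.disc_le_excess hγ (hβu t)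
  have hbt := hbpos t le_rfl
  have hBs : B t ^ 2 / (s : ℝ) = b t ^ 2 := by rw [hb, div_pow, hσ2]
  have hδ0 : 0 ≤ disc ξ (β 0) := by
    have h1 := hpair.excess_nonneg (β 0)
    exact nonneg_of_mul_nonneg_right (h1.trans hQ0) (by positivity)
  have hpow : 0 ≤ (1 - ω) ^ t := pow_nonneg (by linarith) t
  rw [hBs, ← hb, hν, ← hω]
  calc disc ξ (β t) ≤ M / γ * ((1 - ω) ^ t * (2 * M * disc ξ (β 0)) + C * r * b t) := by
        refine hfin.trans ?_
        gcongr
        refine hrec.trans ?_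
        gcongr
    _ ≤ M / γ * ((2 * M + C) * (disc ξ (β 0) * (1 - ω) ^ t + rate s p n
          + r * (b t + b t ^ 2))) := by
        -- The recursion yields only the contracted initial error and r·b_t; the rate and the r·b_t²
        -- term are added as non-negative slack.
        gcongr
        have e1 : 0 ≤ disc ξ (β 0) * (1 - ω) ^ t := by positivity
        have e2 : 0 ≤ r * b t := by positivity
        have e3 : 0 ≤ r * b t ^ 2 := by positivity
        have e4 : 0 ≤ C * (disc ξ (β 0) * (1 - ω) ^ t) := by positivity
        have e5 : 0 ≤ (2 * M + C) * rate s p n := by positivity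
        have e6 : 0 ≤ (2 * M + C) * (r * b t ^ 2) := by positivity
        have e7 : 0 ≤ 2 * M * (r * b t) := by positivity
        linarith
    _ = _ := by ring

end Run

/-! ### Assembling the theorem. -/

/-- The normalization of the variances and the ordering of the quotients force `1 ≤ M` and
`γ ≤ 1`. -/
theorem one_le_and_le_one {p D : ℕ} {M γ : ℝ} (hp : 2 ≤ p) (blk : Fin p → Fin D)
    {S : Matrix (Fin p) (Fin p) ℝ} (hS : S.PosSemidef) (hdiag : ∀ i, S i i = 1)
    (hspec : ∀ d, spectrum ℝ (block blk S d) ⊆ Set.Icc (1 / M) M) (hM : 0 < M) {ξ : ℕ → Fin p → ℝ}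
    (hρ : 0 < rayleigh S (blockDiag blk S) (ξ 1))
    (hgap : γ * rayleigh S (blockDiag blk S) (ξ 1)
      ≤ rayleigh S (blockDiag blk S) (ξ 1) - rayleigh S (blockDiag blk S) (ξ 2)) :
    1 ≤ M ∧ γ ≤ 1 := by
  have hq := blockDiag_quad_bounds blk hS hspec
  constructor
  · have h := (hq (Pi.single ⟨0, by omega⟩ 1)).2
    simpa [blockDiag, hdiag] using h
  · have h1 : 0 ≤ rayleigh S (blockDiag blk S) (ξ 2) := by
      refine div_nonneg (by simpa using hS.dotProduct_mulVec_nonneg (ξ 2)) ?_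
      exact le_trans (mul_nonneg (by positivity) (dotProduct_self_nonneg' _)) (hq (ξ 2)).1
    exact le_of_mul_le_mul_right (by linarith) hρ

/-- With a single block, concentration of the full empirical covariance is a case of the
block-diagonal one. -/
theorem blockDiag_const {p : ℕ} (H : Matrix (Fin p) (Fin p) ℝ) :
    blockDiag (fun _ => (0 : Fin 1)) H = H := by
  ext i j; simp [blockDiag]

end MsCCA

/-- The constants `ψ₁, ψ₂` depend only on `M, γ, c₀, η, c₁, c₂`. The sample size is `n`; all other
objects may vary with `n`. The error bound holds simultaneously for all admissible initial
vectors (which may thus depend on the data) and all runs of the algorithm, outside an event whose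
(outer) probability tends to zero. -/
theorem theorem1 (M γ c₀ η c₁ c₂ : ℝ) (hM : 0 < M) (hγ : 0 < γ) (hc₀ : 0 < c₀) (hc₀' : c₀ < 1)
    (hη : 0 < η) (hη' : η ≤ (1 - c₀) / (2 * M * (M + 3))) (hc₁ : 0 < c₁) (hc₂ : 0 < c₂) :
    ∃ ψ₁ > (0 : ℝ), ∃ ψ₂ > (0 : ℝ),
      ∀ (C : ℝ) (p D s : ℕ → ℕ) (blk : ∀ n, Fin (p n) → Fin (D n))
        (S Lam : ∀ n, Matrix (Fin (p n)) (Fin (p n)) ℝ) (ξ : ∀ n, ℕ → Fin (p n) → ℝ)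
        (ρ : ℕ → ℕ → ℝ) (Linf : ℕ → ℝ) (L B : ℕ → ℕ → ℝ) (ν : ℝ)
        (Ω : ℕ → Type*) [∀ n, MeasurableSpace (Ω n)]
        (P : ∀ n, MeasureTheory.Measure (Ω n)) [∀ n, MeasureTheory.IsProbabilityMeasure (P n)]
        (X : ∀ n, Ω n → Matrix (Fin n) (Fin (p n)) ℝ),
        0 < C →
        (∀ n, 2 ≤ p n) →
        Filter.Tendsto p Filter.atTop Filter.atTop →
        -- covariance, its block-diagonal part, and the data
        (∀ n, (S n).PosSemidef) →
        (∀ n i, S n i i = 1) →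
        (∀ n, Lam n = MsCCA.blockDiag (blk n) (S n)) →
        (∀ n d, spectrum ℝ (MsCCA.block (blk n) (S n) d) ⊆ Set.Icc (1 / M) M) →
        (∀ n, MsCCA.IsGaussianSample (P n) (S n) (X n)) →
        -- population directions, eigen-gap, sparsity
        (∀ n, MsCCA.IsMCCADirections (S n) (Lam n) (ξ n)) →
        (∀ n j, ρ n j = MsCCA.rayleigh (S n) (Lam n) (ξ n j)) →
        (∀ n, 1 + C ≤ ρ n 1) →
        (∀ n, γ * ρ n 1 ≤ ρ n 1 - ρ n 2) →
        (∀ n, s n = MsCCA.l0norm (ξ n 1)) →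
        Filter.Tendsto (fun n => MsCCA.rate (s n) (p n) n) Filter.atTop (nhds 0) →
        -- the sequence of bounds
        (∀ n, 1 ≤ Linf n ∧ Linf n ≤ (1 + c₁) * √(s n : ℝ)) →
        (∀ n t, L n t = MsCCA.bound c₁ c₂ η (Linf n) (s n) (p n) n t) →
        ν = (1 - c₀) * γ ^ 2 / M →
        (∀ n t, B n t = L n t - MsCCA.l1norm (ξ n 1)) →
        Filter.Tendsto (fun n => P n {ω | ¬ ∀ β : ℕ → Fin (p n) → ℝ,
            MsCCA.IsUnitVec (β 0) →
            MsCCA.l1norm (β 0) ≤ L n 0 →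
            MsCCA.disc (ξ n 1) (β 0) ≤ ψ₁ →
            MsCCA.IsProximalRun (MsCCA.empCov (X n ω))
              (MsCCA.blockDiag (blk n) (MsCCA.empCov (X n ω))) η (L n) β →
            ∀ t : ℕ, (t : ℕ∞) ≤ MsCCA.stopTime c₁ c₂ ν (s n) (p n) n (B n) →
              MsCCA.disc (ξ n 1) (β t) ≤
                ψ₂ * (MsCCA.disc (ξ n 1) (β 0) * (1 - η * ν) ^ t + MsCCA.rate (s n) (p n) n
                  + √(MsCCA.rate (s n) (p n) n)
                    * (B n t / √(s n : ℝ) + B n t ^ 2 / (s n : ℝ)))})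
          Filter.atTop (nhds 0) := by
  -- The constants precede the model. If M < 1 or γ > 1 no model satisfies the assumptions, so
  -- arbitrary constants serve.
  by_cases hconst : 1 ≤ M ∧ γ ≤ 1
  swap
  · refine ⟨1, one_pos, 1, one_pos, ?_⟩
    intro C p D s blk S Lam ξ ρ Linf L B ν Ω _ P _ X hC hp _ hS hdiag hLam hspec _ _ hρ hρ1 hgap
    have h1 := hρ1 0
    have h2 := hgap 0
    rw [hρ, hLam] at h1 h2
    rw [hρ, hLam] at h2
    exact absurd (MsCCA.one_le_and_le_one (hp 0) (blk 0) (hS 0) (hdiag 0) (hspec 0) hM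
      (by linarith) h2) hconst
  obtain ⟨hM1, hγ1⟩ := hconst
  -- 2M(M + 3) ≥ 8M since M ≥ 1.
  have hηM : 8 * M * η ≤ 1 := by
    rw [le_div_iff₀ (by positivity)] at hη'
    nlinarith [mul_nonneg hη.le (mul_nonneg hM.le (sub_nonneg.2 hM1))]
  obtain ⟨ψ₁, hψ₁, ψ₂, hψ₂, r₁, hr₁, key⟩ := MsCCA.exists_disc_bound hM1 hγ hγ1 hc₀ hc₀' hη hηM
    hc₁ hc₂ (K := 128 * M) (by positivity)
  refine ⟨ψ₁, hψ₁, ψ₂, hψ₂, ?_⟩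
  intro C p D s blk S Lam ξ ρ Linf L B ν Ω _ P _ X hC hp hptop hS _ hLam hspec hX hξ hρ hρ1 hgap hs
    hrate hLinf hL hν hB
  obtain rfl : Lam = fun n => MsCCA.blockDiag (blk n) (S n) := funext hLam
  obtain rfl : s = fun n => MsCCA.l0norm (ξ n 1) := funext hs
  have hρpos : ∀ n, 0 < MsCCA.rayleigh (S n) (MsCCA.blockDiag (blk n) (S n)) (ξ n 1) := fun n => by
    have := hρ1 n
    rw [hρ] at this
    linarith
  have hpair : ∀ n, MsCCA.IsLeadingPair M γ
      (MsCCA.rayleigh (S n) (MsCCA.blockDiag (blk n) (S n)) (ξ n 1)) (S n)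
      (MsCCA.blockDiag (blk n) (S n)) (ξ n 1) := fun n => by
    have := hgap n
    rw [hρ, hρ] at this
    exact MsCCA.isLeadingPair_of_directions hM (hp n) (blk n) (hS n) (hspec n) (hξ n) (hρpos n)
      this hγ
  have hsqrt : Filter.Tendsto (fun n => √(MsCCA.rate (MsCCA.l0norm (ξ n 1)) (p n) n)) Filter.atTop
      (nhds 0) := by
    simpa [Function.comp_def] using (Real.continuous_sqrt.tendsto 0).comp hrate
  have hlim : Filter.Tendsto (fun n => ENNReal.ofReal (2 / p n) + ENNReal.ofReal (2 / p n))
      Filter.atTop (nhds 0) := by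
    have h1 : Filter.Tendsto (fun n => (2 : ℝ) / p n) Filter.atTop (nhds 0) :=
      (tendsto_natCast_atTop_atTop.comp hptop).const_div_atTop 2
    have h2 := ENNReal.tendsto_ofReal h1
    simpa using h2.add h2
  refine tendsto_of_tendsto_of_tendsto_of_le_of_le' tendsto_const_nhds hlim
    (Filter.Eventually.of_forall fun _ => zero_le) ?_
  filter_upwards [Filter.eventually_ge_atTop 1, hsqrt.eventually (ge_mem_nhds hr₁),
    hsqrt.eventually (ge_mem_nhds (show (0 : ℝ) < 1 / 8 by norm_num))] with n hn hrn hrn8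
  have hs1 := MsCCA.one_le_l0norm (hpair n).unit
  -- For the full covariance the upper bound is Σ ≤ ρ₁M, so its error scales with ρ₁, as the
  -- one-step analysis permits. Together with the block-diagonal event the failure probability is at
  -- most 4/p.
  have hS1 := MsCCA.measure_not_uniform_le hn (hp n) hs1 (fun _ => (0 : Fin 1)) (hS n) (hX n)
    (A := MsCCA.rayleigh (S n) (MsCCA.blockDiag (blk n) (S n)) (ξ n 1) * M)
    (mul_pos (hρpos n) hM) (fun u => by
      rw [MsCCA.blockDiag_const]
      refine ((hpair n).le u).trans ?_
      rw [mul_assoc]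
      exact mul_le_mul_of_nonneg_left ((hpair n).Lam_upper u) (hρpos n).le) (by linarith)
  have hL1 := MsCCA.measure_not_uniform_le hn (hp n) hs1 (blk n) (hS n) (hX n) (A := M) hM
    (hpair n).Lam_upper (by linarith)
  refine le_trans (MeasureTheory.measure_mono ?_)
    ((MeasureTheory.measure_union_le _ _).trans (add_le_add hS1 hL1))
  intro ω hω
  by_contra hcon
  simp only [Set.mem_union, Set.mem_ofPred_eq, not_or, not_not, MsCCA.blockDiag_const] at hcon
  refine hω fun β hβ0 hβ1 hδ hrun => ?_
  refine key (p n) n _ ν (Linf n) (S n) _ _ _ (ξ n 1) (L n) (B n) β (hpair n) (fun u v => ?_)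
    (fun u v => ?_) hrn (by linarith [(hLinf n).1]) (hLinf n).2 (hL n) hν (hB n) hβ0 hβ1 hδ hrun
  · refine (hcon.1 u v).trans (le_of_eq ?_)
    ring
  · exact hcon.2 u v
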